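/- A valued field is a field $K$ together with a valuation ring $\mathcal O_K\subseteq K$ with fraction field $K$; it is always assumed nontrivial, i.e. $\mathcal O_K\neq K$. Let $\mathcal M_K$ be the maximal ideal of $\mathcal O_K$ and $\operatorname{ord}\colon K\to \Gamma\cup\{\infty\}$ the valuation, $\Gamma=K^\times/\mathcal O_K^\times$ (of arbitrary rank). For each integer $N\ge 1$ put $RV_N(K)=K^\times/(1+N\mathcal M_K)\cup\{0\}$, and let $rv_N\colon K\to RV_N(K)$ be the projection on $K^\times$ with $rv_N(0)=0$. For $N\mid M$ let $rv_{N,M}\colon RV_M(K)\to RV_N(K)$ be the induced projection. The map $\operatorname{ord}$ factors through $RV_N(K)$. Let $\mathcal L_{RV}$ be the many-sorted first-order language with sorts $VF$ and $RV_N$ ($N\ge1$), and with: the ring language $0,1,+,-,\cdot$ on $VF$; on each $RV_N$ constants $0,1$, a binary function $\cdot$, a binary relation $\mid$ and a ternary relation $\oplus$; function symbols $rv_N\colon VF\to RV_N$ for all $N$ and $rv_{N,M}\colon RV_M\to RV_N$ for all $N\mid M$; and, for all integers $N,d\ge 1$, a relation symbol $P_{N,d}$ on $RV_N\times RV_{N^2}^{d+1}$.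 A valued field $K$ is an $\mathcal L_{RV}$-structure in the natural way: $VF$ and $RV_N$ are interpreted as $K$ and $RV_N(K)$, and the ring operations, $rv_N$, $rv_{N,M}$ as above; on $RV_N(K)$, $0$ and $1$ are $0$ and $rv_N(1)$, and $\cdot$ is the multiplication of $K^\times/(1+N\mathcal M_K)$ extended by $0\cdot x=x\cdot 0=0$; $\xi\mid\eta$ means $\operatorname{ord}\xi\le\operatorname{ord}\eta$; $\oplus(\xi_1,\xi_2,\xi_3)$ means that there are $x_i\in K$ with $rv_N(x_i)=\xi_i$ and $x_1+x_2=x_3$. Write $\xi_1+\xi_2=\{\xi_3:\oplus(\xi_1,\xi_2,\xi_3)\}$, and extend this to finite sums of elements, which are subsets of $RV_N(K)$. Then $P_{N,d}(\xi,\zeta_0,\dots,\zeta_d)$ means that for all (equivalently, for some) $a_0,\dots,a_d\in K$ with $rv_{N^2}(a_i)=\zeta_i$ the following hold: the $a_i$ are not all zero; $\xi\neq0$; every element $\eta$ of $\sum_{i=1}^d rv_N(ia_i)\,\xi^{i-1}$ satisfies $\operatorname{ord}\eta\le\min_{1\le i\le d}\operatorname{ord}(a_i\xi^{i-1})+\operatorname{ord}N$;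 and there is $\tilde\xi\in RV_{N^2}(K)$ with $rv_{N,N^2}(\tilde\xi)=\xi$ and $0\in\sum_{i=0}^d rv_{N^2}(a_i)\,\tilde\xi^{\,i}$. An existential sentence is a sentence $\exists y\,\varphi(y)$ with $\varphi$ quantifier-free and $y$ a finite tuple of variables of arbitrary sorts. Let $\mathrm{Th}_\exists(K)$ be the set of existential $\mathcal L_{RV}$-sentences true in $K$. Let $\mathcal L_{RV|RV}$ be the restriction of $\mathcal L_{RV}$ to the sorts $(RV_N)_{N\ge1}$ (all symbols involving only these sorts), and let $\mathrm{Th}_\exists(\{RV_N(K)\}_{N\ge1})$ be the set of existential $\mathcal L_{RV|RV}$-sentences true in the $\mathcal L_{RV|RV}$-structure $\{RV_N(K)\}_{N\ge1}$. **Corollary.** Let $K$ and $L$ be (nontrivial) Henselian valued fields of characteristic zero. Then \[ L\models \mathrm{Th}_\exists(K)\quad\text{if and only if}\quad \{RV_N(L)\}_{N\ge1}\models \mathrm{Th}_\exists\big(\{RV_N(K)\}_{N\ge1}\big). \] -/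

import Mathlib

/-! ### Many-sorted first-order logic: existential sentences -/

namespace ManySorted

universe u

/-- A many-sorted first-order signature with set of sorts `S`. A symbol of arity `n` comes with the
tuple `σ : Fin n → S` of sorts of its arguments, and a function symbol with its target sort. -/
structure Signature (S : Type) where
  Functions : (n : ℕ) → (Fin n → S) → S → Type
  Relations : (n : ℕ) → (Fin n → S) → Type

/-- A many-sorted structure. -/
structure Str {S : Type} (Λ : Signature S) where
  Carrier : S → Type u
  funMap : {n : ℕ} → {σ : Fin n → S} → {s : S} →
    Λ.Functions n σ s → ((i : Fin n) → Carrier (σ i)) → Carrier s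
  relMap : {n : ℕ} → {σ : Fin n → S} →
    Λ.Relations n σ → ((i : Fin n) → Carrier (σ i)) → Prop

/-- Terms in the variables `y_0, …, y_{k-1}`, where `y_i` is of sort `τ i`; the last index is the
sort of the term. -/
inductive Term {S : Type} (Λ : Signature S) {k : ℕ} (τ : Fin k → S) : S → Type
  | var (i : Fin k) : Term Λ τ (τ i)
  | app {n : ℕ} {σ : Fin n → S} {s : S} (f : Λ.Functions n σ s)
      (t : (i : Fin n) → Term Λ τ (σ i)) : Term Λ τ s

/-- Quantifier-free formulas in the variables `y_0, …, y_{k-1}`, where `y_i` is of sort `τ i`. -/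
inductive QFFormula {S : Type} (Λ : Signature S) {k : ℕ} (τ : Fin k → S) : Type
  | falsum : QFFormula Λ τ
  | equal {s : S} (t₁ t₂ : Term Λ τ s) : QFFormula Λ τ
  | rel {n : ℕ} {σ : Fin n → S} (R : Λ.Relations n σ)
      (t : (i : Fin n) → Term Λ τ (σ i)) : QFFormula Λ τ
  | not (φ : QFFormula Λ τ) : QFFormula Λ τ
  | and (φ ψ : QFFormula Λ τ) : QFFormula Λ τ
  | or (φ ψ : QFFormula Λ τ) : QFFormula Λ τ

/-- Existential sentences `∃ y_0 ⋯ y_{k-1}, φ(y)` with `φ` quantifier-free and `y` a tuple of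
variables ranging over arbitrary sorts. -/
structure ExistentialSentence {S : Type} (Λ : Signature S) where
  k : ℕ
  sorts : Fin k → S
  matrix : QFFormula Λ sorts

variable {S : Type} {Λ : Signature S}

/-- Value of a term at an assignment. -/
def Term.eval (M : Str.{u} Λ) {k : ℕ} {τ : Fin k → S} (y : (i : Fin k) → M.Carrier (τ i)) :
    {s : S} → Term Λ τ s → M.Carrier s
  | _, .var i => y i
  | _, .app f t => M.funMap f (fun i => (t i).eval M y)

/-- Truth of a quantifier-free formula at an assignment. -/
def QFFormula.Realize (M : Str.{u} Λ) {k : ℕ} {τ : Fin k → S}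
    (y : (i : Fin k) → M.Carrier (τ i)) : QFFormula Λ τ → Prop
  | .falsum => False
  | .equal t₁ t₂ => t₁.eval M y = t₂.eval M y
  | .rel R t => M.relMap R (fun i => (t i).eval M y)
  | .not φ => ¬ φ.Realize M y
  | .and φ ψ => φ.Realize M y ∧ ψ.Realize M y
  | .or φ ψ => φ.Realize M y ∨ ψ.Realize M y

/-- Truth of an existential sentence in a structure. -/
def ExistentialSentence.Realize (φ : ExistentialSentence Λ) (M : Str.{u} Λ) : Prop :=
  ∃ y : (i : Fin φ.k) → M.Carrier (φ.sorts i), φ.matrix.Realize M y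

/-- The existential theory `Th_∃(M)`: all existential sentences that hold in `M`. -/
def Str.existentialTheory (M : Str.{u} Λ) : Set (ExistentialSentence Λ) :=
  {φ | φ.Realize M}

/-- `M ⊨ T` for a set `T` of existential sentences. -/
def Str.Models (M : Str.{u} Λ) (T : Set (ExistentialSentence Λ)) : Prop :=
  ∀ φ ∈ T, φ.Realize M

/-- Restriction of a signature to the set of sorts given by the range of an (injective)
map `ι : S' → S`: keep exactly the symbols all of whose sorts are of the form `ι s'`. -/
def Signature.restrict {S' : Type} (Λ : Signature S) (ι : S' → S) : Signature S' where
  Functions n σ s := Λ.Functions n (fun i => ι (σ i)) (ι s)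
  Relations n σ := Λ.Relations n (fun i => ι (σ i))

/-- Restriction of a structure to the sorts `ι s'`. -/
def Str.restrict {S' : Type} (M : Str.{u} Λ) (ι : S' → S) : Str.{u} (Λ.restrict ι) where
  Carrier s := M.Carrier (ι s)
  funMap {_ _ _} f x := M.funMap (Λ := Λ) f x
  relMap {_ _} R x := M.relMap (Λ := Λ) R x

end ManySorted

/-! ### Leading term structures of a valued field

A valued field is a field `K` with a valuation ring `O : ValuationSubring K`. Mathlib's valuation
`O.valuation` is written multiplicatively, so that `ord x ≤ ord y` is
`O.valuation y ≤ O.valuation x`, and `ord 0 = ∞` corresponds to `O.valuation 0 = 0`. -/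

namespace LeadingTerm

universe u

variable {K : Type u} [Field K] (O : ValuationSubring K)

/-- If `m` lies in the maximal ideal, then `1 + N m` is a unit of the valuation ring. -/
theorem isUnit_one_add (N : ℕ+) {m : O} (hm : m ∈ IsLocalRing.maximalIdeal O) :
    IsUnit (1 + (N : ℕ) * m : O) := by
  have h : ((N : ℕ) : O) * m ∈ IsLocalRing.maximalIdeal O := Ideal.mul_mem_left _ _ hm
  by_contra hu
  have h1 : (1 + (N : ℕ) * m : O) ∈ IsLocalRing.maximalIdeal O :=
    (IsLocalRing.mem_maximalIdeal _).2 hu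
  have h2 : (1 : O) ∈ IsLocalRing.maximalIdeal O := by
    simpa using Ideal.sub_mem _ h1 h
  exact (IsLocalRing.maximalIdeal.isMaximal O).ne_top ((Ideal.eq_top_iff_one _).2 h2)

/-- The subgroup `1 + N 𝓜` of `Kˣ`, where `𝓜` is the maximal ideal of the valuation ring. -/
def oneAddN (N : ℕ+) : Subgroup Kˣ where
  carrier := {x | ∃ m ∈ IsLocalRing.maximalIdeal O, (x : K) = 1 + (N : ℕ) * (m : K)}
  one_mem' := ⟨0, Ideal.zero_mem _, by simp⟩
  mul_mem' := by
    rintro x y ⟨m, hm, hx⟩ ⟨m', hm', hy⟩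
    refine ⟨m + m' + (N : ℕ) * m * m', ?_, ?_⟩
    · exact Ideal.add_mem _ (Ideal.add_mem _ hm hm') (Ideal.mul_mem_left _ _ hm')
    · push_cast
      rw [hx, hy]
      ring
  inv_mem' := by
    rintro x ⟨m, hm, hx⟩
    obtain ⟨w, hw⟩ := isUnit_one_add O N hm
    have hxw : (x : K) = ((w : O) : K) := by
      rw [hw, hx]
      push_cast
      rfl
    have hinv : ((w : O) : K) * (((w⁻¹ : Oˣ) : O) : K) = 1 := by
      exact_mod_cast congrArg (Subtype.val) w.mul_inv
    refine ⟨-(((w⁻¹ : Oˣ) : O) * m), (Ideal.neg_mem_iff _).2 (Ideal.mul_mem_left _ _ hm), ?_⟩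
    have hx0 : (x : K) ≠ 0 := x.ne_zero
    rw [Units.val_inv_eq_inv_val]
    apply mul_left_cancel₀ hx0
    rw [mul_inv_cancel₀ hx0]
    push_cast
    rw [← hxw] at hinv
    linear_combination (N : K) * (m : K) * hinv - hx

/-- The group `RV_Nˣ = Kˣ / (1 + N 𝓜)`. -/
def RVUnits (N : ℕ+) : Type u := Kˣ ⧸ oneAddN O N

noncomputable instance (N : ℕ+) : CommGroup (RVUnits O N) :=
  inferInstanceAs (CommGroup (Kˣ ⧸ oneAddN O N))

/-- The quotient map `Kˣ → RV_Nˣ`. -/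
noncomputable def unitsRV (N : ℕ+) : Kˣ →* RVUnits O N := QuotientGroup.mk' (oneAddN O N)

/-- The leading term structure `RV_N = RV_Nˣ ∪ {0}`, with its multiplication extended
by `0 * x = x * 0 = 0`. -/
abbrev RV (N : ℕ+) : Type u := WithZero (RVUnits O N)

open Classical in
/-- The leading term map `rv_N : K → RV_N`. -/
noncomputable def rv (N : ℕ+) (x : K) : RV O N :=
  if h : x = 0 then 0 else (unitsRV O N (Units.mk0 x h) : RV O N)

theorem oneAddN_le {N M : ℕ+} (h : N ∣ M) : oneAddN O M ≤ oneAddN O N := by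
  rintro x ⟨m, hm, hx⟩
  obtain ⟨c, rfl⟩ := h
  refine ⟨(c : ℕ) * m, Ideal.mul_mem_left _ _ hm, ?_⟩
  rw [hx]
  push_cast
  ring

/-- The projection `RV_M → RV_N` induced by `rv_N`, for `N ∣ M`. -/
noncomputable def rvProj {N M : ℕ+} (h : N ∣ M) : RV O M →*₀ RV O N :=
  WithZero.map' (show RVUnits O M →* RVUnits O N from
    QuotientGroup.map (oneAddN O M) (oneAddN O N) (MonoidHom.id Kˣ) (oneAddN_le O h))

theorem valuation_eq_one_of_mem (N : ℕ+) {x : Kˣ} (hx : x ∈ oneAddN O N) :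
    O.valuation (x : K) = 1 := by
  obtain ⟨m, hm, hx⟩ := hx
  have := (O.valuation_eq_one_iff _).1 (isUnit_one_add O N hm)
  rw [hx]
  simpa using this

/-- The valuation on `RV_N` induced by the valuation of `K`. -/
noncomputable def rvVal (N : ℕ+) : RV O N →*₀ O.ValueGroup :=
  WithZero.lift' (show RVUnits O N →* O.ValueGroup from QuotientGroup.lift (oneAddN O N)
    (O.valuation.toMonoidWithZeroHom.toMonoidHom.comp (Units.coeHom K))
    (fun _ hx => MonoidHom.mem_ker.2 (valuation_eq_one_of_mem O N hx)))

variable {O}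

/-- The relation `ξ ∣ η` on `RV_N`, that is, `ord ξ ≤ ord η`. -/
def RVDvd {N : ℕ+} (ξ η : RV O N) : Prop := rvVal O N η ≤ rvVal O N ξ

/-- The partial addition `⊕(ξ₁, ξ₂, ξ₃)` on `RV_N`. -/
def OPlus {N : ℕ+} (ξ₁ ξ₂ ξ₃ : RV O N) : Prop :=
  ∃ x₁ x₂ x₃ : K, rv O N x₁ = ξ₁ ∧ rv O N x₂ = ξ₂ ∧ rv O N x₃ = ξ₃ ∧ x₁ + x₂ = x₃

/-- The sum `A + B` of two subsets of `RV_N`. -/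
def setAdd {N : ℕ+} (A B : Set (RV O N)) : Set (RV O N) :=
  {ξ₃ | ∃ ξ₁ ∈ A, ∃ ξ₂ ∈ B, OPlus ξ₁ ξ₂ ξ₃}

/-- The set `ξ_1 + ⋯ + ξ_r ⊆ RV_N` for a list of elements of `RV_N`. -/
def listSum {N : ℕ+} : List (RV O N) → Set (RV O N)
  | [] => {0}
  | ξ :: l => setAdd {ξ} (listSum l)

/-- The conditions of Hensel's lemma, in terms of leading terms, on `ξ ∈ RV_N` and the polynomial
`f(x) = a_0 + a_1 x + ⋯ + a_d x^d`:
* `f ≠ 0` and `ξ ≠ 0`;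
* `ord (∑_{i=1}^d rv_N(i a_i) ξ^{i-1}) ≤ min_{1 ≤ i ≤ d} ord (a_i ξ^{i-1}) + ord N`;
* `0 ∈ ∑_{i=0}^d rv_{N²}(a_i) ξ'^i` for some `ξ' ∈ RV_{N²}` lying above `ξ`. -/
def HenselConditions (N : ℕ+) {d : ℕ} (ξ : RV O N) (a : Fin (d + 1) → K) : Prop :=
  (∃ i, a i ≠ 0) ∧ ξ ≠ 0 ∧
  (∀ η ∈ listSum (List.ofFn fun i : Fin d =>
      rv O N (((i : ℕ) + 1 : ℕ) * a i.succ) * ξ ^ (i : ℕ)),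
    ∀ i : Fin d, O.valuation (a i.succ) * rvVal O N ξ ^ (i : ℕ) * O.valuation ((N : ℕ) : K)
      ≤ rvVal O N η) ∧
  ∃ ξ' : RV O (N ^ 2), rvProj O (dvd_pow_self N two_ne_zero) ξ' = ξ ∧
    0 ∈ listSum (List.ofFn fun i : Fin (d + 1) => rv O (N ^ 2) (a i) * ξ' ^ (i : ℕ))

/-- The Hensel lift predicate `P_{N,d}(ξ, ζ_0, …, ζ_d)`. -/
def HenselLift (N : ℕ+) {d : ℕ} (ξ : RV O N) (ζ : Fin (d + 1) → RV O (N ^ 2)) : Prop :=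
  ∀ a : Fin (d + 1) → K, (∀ i, rv O (N ^ 2) (a i) = ζ i) → HenselConditions N ξ a

end LeadingTerm

/-! ### The language `L_RV` and the natural structure on a valued field -/

namespace LRV

open LeadingTerm

universe u

/-- The sorts: the valued field `VF` and the leading term sorts `RV_N`, `N ≥ 1`. -/
inductive Srt : Type
  | VF : Srt
  | RV (N : ℕ+) : Srt

/-- The function symbols. All arguments of a symbol have the same sort,
so that `Fun n (fun _ => t) s` holds symbols of sort `t^n → s`. -/
inductive Fun : (n : ℕ) → (Fin n → Srt) → Srt → Type
  | zeroVF : Fun 0 (fun _ => .VF) .VF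
  | oneVF : Fun 0 (fun _ => .VF) .VF
  | addVF : Fun 2 (fun _ => .VF) .VF
  | negVF : Fun 1 (fun _ => .VF) .VF
  | mulVF : Fun 2 (fun _ => .VF) .VF
  | zeroRV (N : ℕ+) : Fun 0 (fun _ => .RV N) (.RV N)
  | oneRV (N : ℕ+) : Fun 0 (fun _ => .RV N) (.RV N)
  | mulRV (N : ℕ+) : Fun 2 (fun _ => .RV N) (.RV N)
  | rv (N : ℕ+) : Fun 1 (fun _ => .VF) (.RV N)
  | rvProj (N M : ℕ+) (h : N ∣ M) : Fun 1 (fun _ => .RV M) (.RV N)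

/-- The indices `(N, N², …, N²)` of the sorts of the arguments of `P_{N,d}`. -/
def henselIndex (N : ℕ+) (d : ℕ) : Fin (d + 1 + 1) → ℕ+ :=
  Fin.cons N (fun _ => N ^ 2)

/-- The relation symbols; `hensel N d` is the Hensel lift predicate `P_{N,d}`, of sort
`RV_N × RV_{N²}^{d+1}`, for positive integers `N`, `d`. -/
inductive Rel : (n : ℕ) → (Fin n → Srt) → Type
  | div (N : ℕ+) : Rel 2 (fun _ => .RV N)
  | oplus (N : ℕ+) : Rel 3 (fun _ => .RV N)
  | hensel (N d : ℕ+) : Rel ((d : ℕ) + 1 + 1) (fun i => .RV (henselIndex N d i))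

/-- The language `L_RV`. -/
def lang : ManySorted.Signature Srt where
  Functions := Fun
  Relations := Rel

/-- The restriction of `L_RV` to the sorts `RV_N`, `N ≥ 1`. -/
abbrev langRV : ManySorted.Signature ℕ+ := lang.restrict Srt.RV

variable {K : Type u} [Field K] (O : ValuationSubring K)

/-- Interpretation of the sorts. -/
def Carrier : Srt → Type u
  | .VF => K
  | .RV N => RV O N

/-- Interpretation of the function symbols. -/
noncomputable def funMap : {n : ℕ} → {σ : Fin n → Srt} → {s : Srt} →
    Fun n σ s → ((i : Fin n) → Carrier O (σ i)) → Carrier O s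
  | _, _, _, .zeroVF, _ => (0 : K)
  | _, _, _, .oneVF, _ => (1 : K)
  | _, _, _, .addVF, x => let a : K := x 0; let b : K := x 1; a + b
  | _, _, _, .negVF, x => let a : K := x 0; -a
  | _, _, _, .mulVF, x => let a : K := x 0; let b : K := x 1; a * b
  | _, _, _, .zeroRV N, _ => (0 : RV O N)
  | _, _, _, .oneRV N, _ => LeadingTerm.rv O N 1
  | _, _, _, .mulRV N, x => let a : RV O N := x 0; let b : RV O N := x 1; a * b
  | _, _, _, .rv N, x => LeadingTerm.rv O N (x 0 : K)
  | _, _, _, .rvProj _ M h, x => LeadingTerm.rvProj O h (x 0 : RV O M)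

/-- Interpretation of the relation symbols. -/
def relMap : {n : ℕ} → {σ : Fin n → Srt} →
    Rel n σ → ((i : Fin n) → Carrier O (σ i)) → Prop
  | _, _, .div N, x => RVDvd (x 0 : RV O N) (x 1 : RV O N)
  | _, _, .oplus N, x => OPlus (x 0 : RV O N) (x 1 : RV O N) (x 2 : RV O N)
  | _, _, .hensel N d, x =>
      HenselLift (O := O) N (d := d) (x 0 : RV O N) (fun i => (x i.succ : RV O (N ^ 2)))

/-- The natural `L_RV`-structure of the valued field `K` with valuation ring `O`. -/
noncomputable def str : ManySorted.Str.{u} lang where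
  Carrier := Carrier O
  funMap := funMap O
  relMap := relMap O

/-- The structure `{RV_N(K)}_{N ≥ 1}` in the restriction of `L_RV` to the leading term sorts. -/
noncomputable abbrev strRV : ManySorted.Str.{u} langRV := (str O).restrict Srt.RV

end LRV

/-! One direction only reads a sentence about leading terms as a sentence of the full language. For
the other, the hypothesis says that every finite part of the diagram of the leading term sorts of
`K` is realized in those of `L`. Instead of an embedding into a saturated extension of `L`, the
proof uses a proper filter on the families of maps `σ` from `RV_N(K)` to `RV_N(L)`: along it, each
single instance of a symbol is eventually preserved.

A quantifier-free formula at a tuple of `K` involves only finitely many integer polynomials in its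
field coordinates, and these enter through equalities and leading terms. So it suffices that
evaluation of integer polynomials at that tuple is `Approximable`: for finitely many polynomials and
levels, eventually some homomorphism to `L` has the leading terms prescribed by `σ`. This is built
up from the integers one coordinate at a time.

To adjoin `x`, enlarge the given polynomials to a finite set closed under derivatives and let `e` be
closest to `x` among their roots and `0`. Hensel's lemma in `K` shows that the Taylor expansions at
`e` have bounded cancellation at `x` (`exists_root_noCancellation`): otherwise there would be a root
closer to `x`. Hence the leading term of `f(x)` is determined by those of the Taylor coefficients at
`e` and of `x - e`, at a deeper level (`rv_eval₂_of_noCancellation`). This reduces `x` to the root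
`e`.

Roots are treated by induction on the degree of a polynomial `g` vanishing at `x`
(`Approximable.adjoin_root`). Pseudo-division by `g` leaves only polynomials of smaller degree, so
the centre `e` is covered by induction. The predicate `P_{N,d}` holds in `K` for the expansion of
`g` at `e`, passes to `L`, and there yields an exact root by Hensel's lemma
(`HenselConditions.exists_root`). -/

/-! ### Hensel's lemma for arbitrary polynomials. -/

open Polynomial IsLocalRing in
/-- Newton's form of Hensel's lemma for a not necessarily monic polynomial. -/
theorem HenselianLocalRing.exists_root_of_eval_eq_sq_mul {R : Type*} [CommRing R]
    [HenselianLocalRing R] (p : R[X]) (a m : R) (hm : m ∈ maximalIdeal R)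
    (h : p.eval a = p.derivative.eval a ^ 2 * m) :
    ∃ s : R, p.eval (a + p.derivative.eval a * m * s) = 0 := by
  set D := p.derivative.eval a with hD
  set q := taylor a p with hq
  have hq0 : q.coeff 0 = D ^ 2 * m := by rw [hq, taylor_coeff_zero, h]
  have hq1 : q.coeff 1 = D := by rw [hq, taylor_coeff_one]
  set r := q.divX.divX.comp (C (D * m) * X) with hr
  set e := r.natDegree
  -- The displacement `D * m * s` makes the first three parts of the Taylor expansion share the
  -- factor `D ^ 2 * m`; it remains to solve `1 + s + m s² r(s) = 0`.
  have hexp : ∀ s, p.eval (a + D * m * s) = D ^ 2 * m * (1 + s + m * s ^ 2 * r.eval s) := by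
    intro s
    have h1 : p.eval (a + D * m * s) = q.eval (D * m * s) := by
      rw [hq, taylor_eval, add_comm]
    rw [h1]
    conv_lhs => rw [← divX_mul_X_add q, ← divX_mul_X_add q.divX]
    simp only [coeff_divX, eval_add, eval_mul, eval_C, eval_X, zero_add, hq0, hq1, hr, eval_comp]
    ring
  -- Substituting `s = 1/u` and multiplying by `u ^ (e + 2)` makes the equation monic. Modulo the
  -- maximal ideal it becomes `u ^ (e + 1) * (u + 1)`, with simple root `-1`.
  set P : R[X] := X ^ (e + 2) + (X ^ (e + 1) + C m * reflect e r) with hP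
  have hre : (reflect e r).natDegree ≤ e := by
    simpa [e] using natDegree_reflect_le (N := e) (p := r)
  have hPm : P.Monic := by
    apply monic_X_pow_add
    refine lt_of_le_of_lt (degree_le_of_natDegree_le (n := e + 1) ?_) (by norm_cast; omega)
    refine natDegree_add_le_of_degree_le (natDegree_X_pow_le _) ?_
    exact (natDegree_C_mul_le _ _).trans (hre.trans (by omega))
  have h1 : P.eval (-1) ∈ maximalIdeal R := by
    have : P.eval (-1) = m * (reflect e r).eval (-1) := by
      simp only [hP, eval_add, eval_pow, eval_X, eval_mul, eval_C]; ring
    rw [this]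
    exact Ideal.mul_mem_right _ _ hm
  have h2 : IsUnit (P.derivative.eval (-1)) := by
    have h3 : P.derivative.eval (-1) =
        (-1) ^ (e + 1) + m * (derivative (reflect e r)).eval (-1) := by
      simp only [hP, derivative_add, derivative_X_pow, derivative_mul, derivative_C, eval_add,
        eval_pow, eval_X, eval_mul, eval_C, zero_mul, zero_add]
      push_cast
      ring
    have hu : IsUnit ((-1 : R) ^ (e + 1)) := (isUnit_one.neg).pow _
    have hmem := Ideal.mul_mem_right ((derivative (reflect e r)).eval (-1)) _ hm
    rw [h3]
    by_contra hn
    exact ((mem_maximalIdeal _).1 ((Ideal.add_mem_iff_left _ hmem).1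
      ((mem_maximalIdeal _).2 hn))) hu
  obtain ⟨u, hu0, hu1⟩ := HenselianLocalRing.is_henselian P hPm (-1) h1 h2
  have huu : IsUnit u := by
    by_contra hn
    have := Ideal.sub_mem _ ((mem_maximalIdeal u).2 hn) hu1
    exact (mem_maximalIdeal _).1 this (by simp)
  obtain ⟨w, rfl⟩ := huu
  let _ : Invertible ((w⁻¹ : Rˣ) : R) := ⟨w, by simp, by simp⟩
  have hrefl := eval₂_reflect_mul_pow (RingHom.id R) ((w⁻¹ : Rˣ) : R) e r le_rfl
  refine ⟨((w⁻¹ : Rˣ) : R), ?_⟩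
  rw [hexp]
  change eval (w : R) (reflect e r) * _ = eval _ r at hrefl
  have hw : (w : R) * ((w⁻¹ : Rˣ) : R) = 1 := by simp
  have hwe : ∀ n, (w : R) ^ n * ((w⁻¹ : Rˣ) : R) ^ n = 1 := fun n => by
    rw [← mul_pow, hw, one_pow]
  rw [← hrefl]
  set v := ((w⁻¹ : Rˣ) : R)
  have h0 : (w : R) ^ (e + 2) + ((w : R) ^ (e + 1) + m * eval (w : R) (reflect e r)) = 0 := by
    simpa [hP] using hu0
  have : 1 + v + m * v ^ 2 * (eval (w : R) (reflect e r) * v ^ e) = 0 := by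
    linear_combination v ^ (e + 2) * h0 - hwe (e + 2) - v * hwe (e + 1)
  rw [this, mul_zero]

/-! ### Leading terms and their sums. -/

namespace LeadingTerm

universe u

variable {K : Type u} [Field K] (O : ValuationSubring K)

@[simp] theorem rv_zero (N : ℕ+) : rv O N 0 = 0 := by simp [rv]

theorem rv_of_ne_zero (N : ℕ+) {x : K} (h : x ≠ 0) :
    rv O N x = (unitsRV O N (Units.mk0 x h) : RV O N) := by simp [rv, h]

@[simp] theorem rv_eq_zero_iff (N : ℕ+) {x : K} : rv O N x = 0 ↔ x = 0 := by
  by_cases h : x = 0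
  · simp [h]
  · simp [rv_of_ne_zero O N h, h]

@[simp] theorem rv_one (N : ℕ+) : rv O N 1 = 1 := by
  rw [rv_of_ne_zero O N one_ne_zero, Units.mk0_one, map_one, WithZero.coe_one]

theorem rv_mul (N : ℕ+) (x y : K) : rv O N (x * y) = rv O N x * rv O N y := by
  by_cases hx : x = 0
  · simp [hx]
  by_cases hy : y = 0
  · simp [hy]
  rw [rv_of_ne_zero O N hx, rv_of_ne_zero O N hy, rv_of_ne_zero O N (mul_ne_zero hx hy),
    Units.mk0_mul, map_mul, WithZero.coe_mul]

theorem rv_pow (N : ℕ+) (x : K) (n : ℕ) : rv O N (x ^ n) = rv O N x ^ n := by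
  induction n with
  | zero => simp
  | succ n ih => rw [pow_succ, rv_mul, ih, pow_succ]

theorem rv_surjective (N : ℕ+) : Function.Surjective (rv O N) := by
  intro ξ
  induction ξ using WithZero.recZeroCoe with
  | zero => exact ⟨0, rv_zero O N⟩
  | coe a =>
    obtain ⟨x, rfl⟩ := QuotientGroup.mk'_surjective (oneAddN O N) a
    refine ⟨x, ?_⟩
    rw [rv_of_ne_zero O N x.ne_zero, Units.mk0_val]
    rfl

theorem rv_eq_rv_iff (N : ℕ+) {x y : K} :
    rv O N x = rv O N y ↔ ∃ m : K, O.valuation m < 1 ∧ y = x * (1 + (N : ℕ) * m) := by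
  by_cases hx : x = 0
  · subst hx
    simp only [rv_zero, zero_mul]
    rw [eq_comm, rv_eq_zero_iff]
    exact ⟨fun h => ⟨0, by simp, h⟩, fun ⟨_, _, h⟩ => h⟩
  by_cases hy : y = 0
  · subst hy
    simp only [rv_zero, rv_eq_zero_iff, hx, false_iff, not_exists, not_and]
    intro m hm h
    rcases mul_eq_zero.1 h.symm with h | h
    · exact hx h
    · have hm' : O.valuation m ≤ 1 := hm.le
      have hu := isUnit_one_add O N (m := ⟨m, O.mem_of_valuation_le_one m hm'⟩)
        ((O.valuation_lt_one_iff _).2 hm)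
      apply hu.ne_zero
      apply Subtype.val_injective
      push_cast
      exact h
  rw [rv_of_ne_zero O N hx, rv_of_ne_zero O N hy, WithZero.coe_inj]
  refine (QuotientGroup.eq (s := oneAddN O N)).trans ?_
  constructor
  · rintro ⟨m, hm, h⟩
    refine ⟨m, (O.valuation_lt_one_iff _).1 hm, ?_⟩
    rw [← h]
    simp [hx]
  · rintro ⟨m, hm, h⟩
    refine ⟨⟨m, O.mem_of_valuation_le_one m hm.le⟩, (O.valuation_lt_one_iff _).2 hm, ?_⟩
    simp [h]

@[simp] theorem rvVal_rv (N : ℕ+) (x : K) : rvVal O N (rv O N x) = O.valuation x := by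
  by_cases hx : x = 0
  · simp [hx]
  · rw [rv_of_ne_zero O N hx]
    rfl

@[simp] theorem rvProj_rv {N M : ℕ+} (h : N ∣ M) (x : K) : rvProj O h (rv O M x) = rv O N x := by
  by_cases hx : x = 0
  · simp [hx]
  · rw [rv_of_ne_zero O N hx, rv_of_ne_zero O M hx]
    rfl

theorem rv_eq_rv_of_dvd {N M : ℕ+} (h : N ∣ M) {x y : K} (hxy : rv O M x = rv O M y) :
    rv O N x = rv O N y := by
  rw [← rvProj_rv O h, hxy, rvProj_rv]

theorem valuation_eq_of_rv_eq {N : ℕ+} {x y : K} (h : rv O N x = rv O N y) :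
    O.valuation x = O.valuation y := by
  rw [← rvVal_rv O N, h, rvVal_rv]

theorem valuation_natCast_le_one (n : ℕ) : O.valuation (n : K) ≤ 1 := by
  exact_mod_cast O.valuation_le_one (n : O)

theorem valuation_natCast_le_of_dvd {m n : ℕ} (h : m ∣ n) :
    O.valuation (n : K) ≤ O.valuation (m : K) := by
  obtain ⟨c, rfl⟩ := h
  rw [Nat.cast_mul, map_mul]
  exact mul_le_of_le_one_right' (valuation_natCast_le_one O c)

section CharZero

variable [CharZero K]

theorem valuation_pnat_pos (N : ℕ+) : 0 < O.valuation ((N : ℕ) : K) := by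
  rw [Valuation.pos_iff]
  exact_mod_cast N.ne_zero

theorem rv_eq_rv_of_valuation_sub_lt {N : ℕ+} {x y : K}
    (h : O.valuation (y - x) < O.valuation ((N : ℕ) : K) * O.valuation x) :
    rv O N x = rv O N y := by
  have hN : ((N : ℕ) : K) ≠ 0 := by exact_mod_cast N.ne_zero
  have hx : x ≠ 0 := by
    rintro rfl
    simp at h
  refine (rv_eq_rv_iff O N).2 ⟨(y - x) / (N * x), ?_, by field_simp; ring⟩
  rw [map_div₀, map_mul, div_lt_one₀]
  · exact h
  · exact mul_pos (valuation_pnat_pos O N) ((Valuation.pos_iff _).2 hx)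

theorem valuation_sub_lt_of_rv_eq {N : ℕ+} {x y : K} (h : rv O N x = rv O N y) (hx : x ≠ 0) :
    O.valuation (y - x) < O.valuation ((N : ℕ) : K) * O.valuation x := by
  obtain ⟨m, hm, rfl⟩ := (rv_eq_rv_iff O N).1 h
  have : x * (1 + (N : ℕ) * m) - x = (N : ℕ) * x * m := by ring
  rw [this, map_mul, map_mul]
  have := mul_pos (valuation_pnat_pos O N) ((Valuation.pos_iff O.valuation).2 hx)
  exact mul_lt_of_lt_one_right this hm

/-- Replacing the summands of a sum by elements with the same leading terms of order `N` changes
the sum by less than `c`, as soon as all summands times `N` have value at most `c`. -/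
theorem valuation_sum_sub_sum_lt {N : ℕ+} {n : ℕ} {x y : Fin n → K}
    (h : ∀ i, rv O N (x i) = rv O N (y i)) {c : O.ValueGroup} (hc : 0 < c)
    (hx : ∀ i, O.valuation (x i) * O.valuation ((N : ℕ) : K) ≤ c) :
    O.valuation (∑ i, y i - ∑ i, x i) < c := by
  rw [← Finset.sum_sub_distrib]
  refine Valuation.map_sum_lt' _ hc fun i _ => ?_
  by_cases h0 : x i = 0
  · have h1 : y i = 0 := by
      have := h i
      rwa [h0, rv_zero, eq_comm, rv_eq_zero_iff] at this
    simpa [h0, h1] using hc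
  · exact (valuation_sub_lt_of_rv_eq O (h i) h0).trans_le ((mul_comm _ _).trans_le (hx i))

end CharZero

variable {O}

/-- The iterated definition picks new representatives at each addition. Two representatives of a
partial sum differ by a factor `1 + N m`, and multiplying all summands by it changes none of their
leading terms. -/
theorem mem_listSum_iff {N : ℕ+} (l : List (RV O N)) (η : RV O N) :
    η ∈ listSum l ↔ ∃ xs : List K, xs.map (rv O N) = l ∧ rv O N xs.sum = η := by
  induction l generalizing η with
  | nil => simp [listSum, eq_comm]
  | cons ξ l ih =>
    simp only [listSum, setAdd, Set.mem_ofPred_eq, Set.mem_singleton_iff, exists_eq_left]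
    constructor
    · rintro ⟨ξ₂, h2, x₁, x₂, x₃, rfl, hx2, rfl, rfl⟩
      obtain ⟨xs, rfl, hs⟩ := (ih _).1 h2
      obtain ⟨m, hm, rfl⟩ := (rv_eq_rv_iff O N).1 (hs.trans hx2.symm)
      refine ⟨x₁ :: xs.map (· * (1 + (N : ℕ) * m)), ?_, ?_⟩
      · simp only [List.map_cons, List.map_map, List.cons.injEq, true_and]
        refine List.map_congr_left fun x _ => ?_
        exact ((rv_eq_rv_iff O N).2 ⟨m, hm, rfl⟩).symm
      · rw [List.sum_cons, List.sum_map_mul_right, List.map_id']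
    · rintro ⟨xs, hxs, rfl⟩
      obtain ⟨x, xs, rfl⟩ : ∃ x xs', xs = x :: xs' := by
        cases xs with
        | nil => simp at hxs
        | cons x xs => exact ⟨x, xs, rfl⟩
      simp only [List.map_cons, List.cons.injEq] at hxs
      exact ⟨_, (ih _).2 ⟨xs, hxs.2, rfl⟩, x, xs.sum, _, hxs.1, rfl, rfl, by simp⟩

theorem mem_listSum_ofFn_iff {N : ℕ+} {n : ℕ} (ξ : Fin n → RV O N) (η : RV O N) :
    η ∈ listSum (List.ofFn ξ) ↔
      ∃ x : Fin n → K, (∀ i, rv O N (x i) = ξ i) ∧ rv O N (∑ i, x i) = η := by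
  rw [mem_listSum_iff]
  constructor
  · rintro ⟨xs, hxs, rfl⟩
    obtain rfl : xs.length = n := by simpa using congrArg List.length hxs
    refine ⟨xs.get, fun i => ?_, ?_⟩
    · have := congrArg (fun l => l[(i : ℕ)]?) hxs
      simpa using this
    · rw [← List.sum_ofFn, List.ofFn_get]
  · rintro ⟨x, hx, rfl⟩
    exact ⟨List.ofFn x, by simp [List.map_ofFn, Function.comp_def, hx], by rw [List.sum_ofFn]⟩

end LeadingTerm

/-! ### Hensel's lemma and Taylor expansions without cancellation. -/

namespace LeadingTerm

universe u

open Polynomial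

variable {K : Type u} [Field K] (O : ValuationSubring K)

section Hensel

variable [CharZero K] [HenselianLocalRing O]

/-- Hensel's lemma normalized to the approximate root `1`. Dividing `p` by a coefficient of maximal
value gives an integral `q` with `|q'(1)| ≥ |N|` and `|q(1)| < |N|²`; Newton's form then moves `1`
by at most `|q(1) / q'(1)| < |N|`. -/
theorem exists_root_of_valuation_eval_one_lt (p : K[X]) (N : ℕ+)
    (h1 : ∀ k, 1 ≤ k → O.valuation (p.coeff k) * O.valuation ((N : ℕ) : K) ≤
      O.valuation (p.derivative.eval 1))
    (h0 : ∃ k, O.valuation (p.eval 1) < O.valuation (p.coeff k) * O.valuation ((N : ℕ) : K) ^ 2) :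
    ∃ t, p.eval t = 0 ∧ O.valuation (t - 1) < O.valuation ((N : ℕ) : K) := by
  have hNpos := valuation_pnat_pos O N
  have hN1 : O.valuation ((N : ℕ) : K) ≤ 1 := valuation_natCast_le_one O N
  obtain ⟨k₁, hk₁⟩ := h0
  have hk₁0 : p.coeff k₁ ≠ 0 := by
    intro h
    simp [h] at hk₁
  have hne : p.support.Nonempty := ⟨k₁, mem_support_iff.2 hk₁0⟩
  obtain ⟨k₀, hk₀, hmax⟩ := p.support.exists_max_image (fun k => O.valuation (p.coeff k)) hne
  replace hmax : ∀ k, O.valuation (p.coeff k) ≤ O.valuation (p.coeff k₀) := by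
    intro k
    by_cases hk : p.coeff k = 0
    · simp [hk]
    · exact hmax k (mem_support_iff.2 hk)
  set b := p.coeff k₀ with hb
  have hb0 : b ≠ 0 := mem_support_iff.1 hk₀
  have hbpos : 0 < O.valuation b := (Valuation.pos_iff _).2 hb0
  have hp1 : O.valuation (p.eval 1) < O.valuation b * O.valuation ((N : ℕ) : K) ^ 2 :=
    hk₁.trans_le (mul_le_mul_left (hmax k₁) _)
  have hp1' : O.valuation (p.eval 1) < O.valuation b :=
    hp1.trans_le (mul_le_of_le_one_right' (pow_le_one' hN1 2))
  have hder : O.valuation b * O.valuation ((N : ℕ) : K) ≤ O.valuation (p.derivative.eval 1) := by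
    by_cases hk : 1 ≤ k₀
    · exact h1 k₀ hk
    -- If only the constant coefficient were maximal, it would dominate `p(1)`, against the
    -- smallness of `p(1)`.
    · obtain rfl : k₀ = 0 := by omega
      by_contra! hlt
      have hsmall : ∀ k, 1 ≤ k → O.valuation (p.coeff k) < O.valuation b := by
        intro k hk
        have := (h1 k hk).trans_lt hlt
        exact lt_of_mul_lt_mul_right' this
      have hsum : p.eval 1 = ∑ k ∈ Finset.range p.natDegree, p.coeff (k + 1) + b := by
        rw [eval_eq_sum_range, Finset.sum_range_succ']
        simp [hb]
      have h2 : O.valuation (∑ k ∈ Finset.range p.natDegree, p.coeff (k + 1)) < O.valuation b :=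
        Valuation.map_sum_lt' _ hbpos fun k _ => hsmall _ (by omega)
      rw [hsum, Valuation.map_add_eq_of_lt_right _ h2] at hp1'
      exact lt_irrefl _ hp1'
  obtain ⟨q, hq⟩ : ∃ q : O[X], q.map (algebraMap O K) = C b⁻¹ * p := by
    rw [← mem_lifts, lifts_iff_coeff_lifts]
    intro n
    refine ⟨⟨b⁻¹ * p.coeff n, O.mem_of_valuation_le_one _ ?_⟩, by rw [coeff_C_mul]; rfl⟩
    rw [map_mul, map_inv₀, inv_mul_le_one₀ hbpos]
    exact hmax n
  have hqe : ∀ t : O, algebraMap O K (q.eval t) = b⁻¹ * p.eval (t : K) := by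
    intro t
    rw [← eval₂_at_apply, ← eval_map, hq]
    simp
  have hqd : algebraMap O K (q.derivative.eval 1) = b⁻¹ * p.derivative.eval 1 := by
    rw [← eval₂_at_apply, ← eval_map, ← derivative_map, hq]
    simp
  set D := q.derivative.eval 1 with hD
  have hDv : O.valuation ((N : ℕ) : K) ≤ O.valuation (algebraMap O K D) := by
    rw [hqd, map_mul, map_inv₀, le_inv_mul_iff₀ hbpos]
    exact hder
  have hDpos : 0 < O.valuation (algebraMap O K D) := hNpos.trans_le hDv
  have hD0 : algebraMap O K D ≠ 0 := (Valuation.pos_iff _).1 hDpos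
  have hq1 : O.valuation (algebraMap O K (q.eval 1)) < O.valuation ((N : ℕ) : K) ^ 2 := by
    rw [hqe, map_mul, map_inv₀, inv_mul_lt_iff₀ hbpos]
    exact hp1
  have hqD : O.valuation (algebraMap O K (q.eval 1)) < O.valuation (algebraMap O K D) ^ 2 :=
    hq1.trans_le (pow_le_pow_left' hDv 2)
  set m : K := algebraMap O K (q.eval 1) / algebraMap O K D ^ 2 with hm
  have hm1 : O.valuation m < 1 := by
    rw [hm, map_div₀, map_pow, div_lt_one₀ (pow_pos hDpos 2)]
    exact hqD
  obtain ⟨s, hs⟩ := HenselianLocalRing.exists_root_of_eval_eq_sq_mul q 1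
    ⟨m, O.mem_of_valuation_le_one m hm1.le⟩ ((O.valuation_lt_one_iff _).2 hm1) (by
      apply FaithfulSMul.algebraMap_injective O K
      rw [map_mul, map_pow]
      change _ = _ * m
      rw [hm, mul_div_cancel₀ _ (pow_ne_zero 2 hD0)])
  refine ⟨1 + algebraMap O K D * m * s, ?_, ?_⟩
  · have := hqe (1 + D * ⟨m, O.mem_of_valuation_le_one m hm1.le⟩ * s)
    rw [hs, map_zero, eq_comm, mul_eq_zero, or_iff_right (inv_ne_zero hb0)] at this
    exact this
  · rw [add_sub_cancel_left, map_mul]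
    refine lt_of_le_of_lt (mul_le_of_le_one_right' (O.valuation_le_one s)) ?_
    have : algebraMap O K D * m = algebraMap O K (q.eval 1) / algebraMap O K D := by
      rw [hm]; field_simp
    rw [this, map_div₀, div_lt_iff₀ hDpos]
    refine hq1.trans_le ?_
    rw [sq]
    exact mul_le_mul_right hDv _

end Hensel

/-- The Taylor expansion of `f` at `e` is free of cancellation at `x`, up to `M`:
no term `f_k (x - e) ^ k`, multiplied by `M`, has larger absolute value than `f(x)`. -/
def NoCancellation (M : ℕ+) (f : K[X]) (e x : K) : Prop :=
  ∀ k, O.valuation ((taylor e f).coeff k) * O.valuation (x - e) ^ k * O.valuation ((M : ℕ) : K) ≤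
    O.valuation (f.eval x)

variable {O}

theorem NoCancellation.of_dvd {M M' : ℕ+} {f : K[X]} {e x : K} (h : NoCancellation O M f e x)
    (hM : M ∣ M') : NoCancellation O M' f e x := fun k =>
  (mul_le_mul_right (valuation_natCast_le_of_dvd O (PNat.dvd_iff.1 hM)) _).trans (h k)

theorem noCancellation_of_natDegree_eq_zero {f : K[X]} (hf : f.natDegree = 0) (e x : K) :
    NoCancellation O 1 f e x := by
  rw [eq_C_of_natDegree_eq_zero hf]
  intro k
  rw [taylor_C, coeff_C]
  split_ifs with h
  · simp [h]
  · simp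

theorem noCancellation_self (f : K[X]) (e : K) : NoCancellation O 1 f e e := by
  intro k
  rcases k with _ | k
  · simp
  · simp

/-- The polynomial `f(e + (x - e) T)` in `T`. -/
noncomputable def rescale (f : K[X]) (e x : K) : K[X] := (taylor e f).comp (C (x - e) * X)

theorem coeff_rescale (f : K[X]) (e x : K) (k : ℕ) :
    (rescale f e x).coeff k = (taylor e f).coeff k * (x - e) ^ k := comp_C_mul_X_coeff

theorem eval_rescale (f : K[X]) (e x t : K) :
    (rescale f e x).eval t = f.eval (e + (x - e) * t) := by
  simp [rescale, taylor_eval, add_comm]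

theorem derivative_rescale_eval_one (f : K[X]) (e x : K) :
    (rescale f e x).derivative.eval 1 = (x - e) * f.derivative.eval x := by
  simp [rescale, taylor_apply, derivative_comp]

theorem coeff_taylor_derivative (f : K[X]) (e : K) (k : ℕ) :
    (taylor e (derivative f)).coeff k = (taylor e f).coeff (k + 1) * (k + 1) := by
  rw [← coeff_derivative]
  simp [taylor_apply, derivative_comp]

/-- Differentiation multiplies the coefficient of index `k` by `k`. The factorial of the degree is
divisible by every index that occurs, so it absorbs this loss. -/
theorem NoCancellation.valuation_coeff_rescale_le {M N : ℕ+} {f : K[X]} {e x : K}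
    (h : NoCancellation O M (derivative f) e x) (hN : (M : ℕ) * f.natDegree.factorial ∣ N)
    (k : ℕ) (hk : 1 ≤ k) :
    O.valuation ((rescale f e x).coeff k) * O.valuation ((N : ℕ) : K) ≤
      O.valuation ((rescale f e x).derivative.eval 1) := by
  by_cases hkd : f.natDegree < k
  · rw [coeff_rescale, coeff_eq_zero_of_natDegree_lt (by rwa [natDegree_taylor])]
    simp
  obtain ⟨k, rfl⟩ : ∃ j, k = j + 1 := ⟨k - 1, by omega⟩
  have h1 := mul_le_mul_right (h k) (O.valuation (x - e))
  rw [coeff_taylor_derivative] at h1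
  rw [derivative_rescale_eval_one, map_mul (O.valuation) (x - e)]
  refine le_trans ?_ h1
  have hkN : M * (k + 1) ∣ (N : ℕ) := by
    exact (mul_dvd_mul_left _ (Nat.dvd_factorial (by omega) (by omega))).trans hN
  have h2 := valuation_natCast_le_of_dvd (K := K) O hkN
  rw [coeff_rescale, map_mul, map_pow, map_mul]
  refine (mul_le_mul_right h2 _).trans (le_of_eq ?_)
  push_cast
  rw [map_mul]
  simp only [pow_succ, mul_assoc, mul_comm, mul_left_comm]

section Hensel

variable [CharZero K] [HenselianLocalRing O]

/-- If the expansion of `f'` at `e` has no cancellation at `x`, then neither has that of `f`,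
unless `f` has a root closer to `x` than `e`. -/
theorem noCancellation_or_exists_root {M N : ℕ+} {f : K[X]} {e x : K} (hxe : x ≠ e)
    (h : NoCancellation O M (derivative f) e x) (hN : (M : ℕ) * f.natDegree.factorial ∣ N) :
    NoCancellation O (N ^ 2) f e x ∨
      f ≠ 0 ∧ ∃ c, f.eval c = 0 ∧ O.valuation (x - c) < O.valuation (x - e) := by
  by_cases hc : NoCancellation O (N ^ 2) f e x
  · exact Or.inl hc
  right
  simp only [NoCancellation, not_forall, not_le] at hc
  obtain ⟨k, hk⟩ := hc
  -- In the coordinate `T` of `rescale`, `e` is `0` and `x` is `1`; a root within `|N| ≤ 1` of `1`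
  -- is therefore closer to `x` than `e` is.
  obtain ⟨t, ht, ht1⟩ := exists_root_of_valuation_eval_one_lt O (rescale f e x) N
    (h.valuation_coeff_rescale_le hN) ⟨k, by
      rw [eval_rescale, coeff_rescale]
      simpa using hk⟩
  refine ⟨?_, e + (x - e) * t, by rwa [eval_rescale] at ht, ?_⟩
  · rintro rfl
    simp at hk
  · have h1 : x - (e + (x - e) * t) = (x - e) * -(t - 1) := by ring
    rw [h1, map_mul, Valuation.map_neg]
    exact mul_lt_of_lt_one_right ((Valuation.pos_iff _).2 (sub_ne_zero.2 hxe))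
      (ht1.trans_le (valuation_natCast_le_one O N))

/-- For a finite set of polynomials that is closed under derivatives, all expansions at the root
`e` that is closest to `x` are free of cancellation at `x`. -/
theorem exists_root_noCancellation (F : Finset K[X]) (hF : ∀ f ∈ F, derivative f ∈ F) (x : K) :
    ∃ (e : K) (M : ℕ+), (e = 0 ∨ ∃ f ∈ F, f ≠ 0 ∧ f.eval e = 0) ∧
      ∀ f ∈ F, NoCancellation O M f e x := by
  classical
  -- The point `0` guarantees a centre even when no polynomial has a root.
  set Z : Finset K := insert 0 (F.biUnion fun f => f.roots.toFinset) with hZ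
  have hmem : ∀ c, c ∈ Z ↔ c = 0 ∨ ∃ f ∈ F, f ≠ 0 ∧ f.eval c = 0 := by
    intro c
    simp [hZ, IsRoot.def]
  obtain ⟨e, he, hmin⟩ := Z.exists_min_image (fun c => O.valuation (x - c)) ⟨0, by simp [hZ]⟩
  have hex : ∀ n, ∀ f ∈ F, f.natDegree ≤ n → ∃ M, NoCancellation O M f e x := by
    intro n
    induction n with
    | zero => exact fun f _ hf => ⟨1, noCancellation_of_natDegree_eq_zero (by omega) e x⟩
    | succ n ih =>
      intro f hf hn
      by_cases hxe : x = e
      · exact ⟨1, hxe ▸ noCancellation_self f x⟩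
      obtain ⟨M, hM⟩ := ih _ (hF f hf) ((natDegree_derivative_le f).trans (by omega))
      rcases noCancellation_or_exists_root
          (N := ⟨M * f.natDegree.factorial, Nat.mul_pos M.pos (Nat.factorial_pos _)⟩)
          hxe hM dvd_rfl with h | ⟨hf0, c, hc, hlt⟩
      · exact ⟨_, h⟩
      · exact absurd (hmin c ((hmem c).2 (Or.inr ⟨f, hf, hf0, hc⟩))) (not_le.2 hlt)
  choose! M hM using fun f hf => hex _ f hf le_rfl
  exact ⟨e, ∏ f ∈ F, M f, (hmem e).1 he, fun f hf => (hM f hf).of_dvd (Finset.dvd_prod_of_mem M hf)⟩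

end Hensel

end LeadingTerm

/-! ### The conditions behind the Hensel lift predicate. -/

namespace LeadingTerm

universe u

open Polynomial

variable {K : Type u} [Field K] {O : ValuationSubring K}

theorem sum_coeff_taylor_mul_pow {A : Type*} [CommRing A] (f : A[X]) (e x : A) {n : ℕ}
    (hn : f.natDegree < n) :
    ∑ i : Fin n, (taylor e f).coeff i * (x - e) ^ (i : ℕ) = f.eval x := by
  rw [← taylor_eval_sub e f x, eval_eq_sum_range' (by rwa [natDegree_taylor])]
  exact Fin.sum_univ_eq_sum_range (fun i => (taylor e f).coeff i * (x - e) ^ i) n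

variable [CharZero K]

/-- This makes `P_{N,d}` true in `K`. The coefficients `b` are arbitrary representatives because the
predicate quantifies over all of them; the lift of `ξ` is the leading term of `x - e` itself, as the
expansion of `g` at `e` sums to `g(x) = 0`. -/
theorem henselConditions_of_noCancellation {M N : ℕ+} {g : K[X]} {d : ℕ} (hd : g.natDegree ≤ d)
    {e x : K} (hg : g ≠ 0) (hgx : g.eval x = 0) (hxe : x ≠ e)
    (h : NoCancellation O M (derivative g) e x) (hN : (M : ℕ) * g.natDegree.factorial ∣ N)
    (b : Fin (d + 1) → K)
    (hb : ∀ i : Fin (d + 1), rv O (N ^ 2) (b i) = rv O (N ^ 2) ((taylor e g).coeff i)) :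
    HenselConditions N (rv O N (x - e)) b := by
  have hxe' : x - e ≠ 0 := sub_ne_zero.2 hxe
  have hpos : 0 < O.valuation (x - e) := (Valuation.pos_iff _).2 hxe'
  have hdvd : N ∣ N ^ 2 := dvd_pow_self N two_ne_zero
  refine ⟨?_, by simpa using hxe', ?_, rv O (N ^ 2) (x - e), rvProj_rv O _ _, ?_⟩
  · have hlc : (taylor e g).coeff g.natDegree ≠ 0 := by
      rw [coeff_taylor_natDegree]
      exact leadingCoeff_ne_zero.2 hg
    refine ⟨⟨g.natDegree, by omega⟩, fun h0 => hlc ?_⟩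
    have := hb ⟨g.natDegree, by omega⟩
    rwa [h0, rv_zero, eq_comm, rv_eq_zero_iff] at this
  · intro η hη i
    obtain ⟨w, hw, rfl⟩ := (mem_listSum_ofFn_iff _ _).1 hη
    rw [rvVal_rv, rvVal_rv]
    set u : Fin d → K := fun i => (taylor e (derivative g)).coeff i * (x - e) ^ (i : ℕ) with hu
    have hsum : ∑ i, u i = g.derivative.eval x := by
      rcases Nat.eq_zero_or_pos g.natDegree with h0 | h0
      · rw [hu, eq_C_of_natDegree_eq_zero h0]
        simp
      · exact sum_coeff_taylor_mul_pow _ _ _ ((natDegree_derivative_lt h0.ne').trans_le hd)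
    have hwu : ∀ i, rv O N (u i) = rv O N (w i) := by
      intro i
      rw [hw, hu, ← rv_pow, rv_mul, rv_mul, coeff_taylor_derivative, rv_mul,
        rv_eq_rv_of_dvd O hdvd (hb i.succ), Fin.val_succ, mul_comm (rv O N (coeff _ _))]
      push_cast
      rfl
    have hle : O.valuation (b i.succ) * O.valuation (x - e) ^ (i : ℕ) *
        O.valuation ((N : ℕ) : K) ≤ O.valuation (g.derivative.eval x) := by
      have h1 := h.valuation_coeff_rescale_le hN ((i : ℕ) + 1) (by omega)
      rw [coeff_rescale, derivative_rescale_eval_one, map_mul, map_mul, map_pow, pow_succ',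
        mul_left_comm, mul_assoc, mul_le_mul_iff_right₀ hpos] at h1
      rw [valuation_eq_of_rv_eq O (hb i.succ)]
      exact h1
    refine hle.trans ?_
    by_cases h0 : g.derivative.eval x = 0
    · simp [h0]
    -- Since `M` divides `N`, changing representatives moves the sum by less than `|g'(x)|`, so its
    -- value is unchanged.
    · have hlt := valuation_sum_sub_sum_lt O hwu ((Valuation.pos_iff _).2 h0) (fun i => by
        rw [hu, map_mul, map_pow]
        exact h.of_dvd (PNat.dvd_iff.2 ((Dvd.intro _ rfl).trans hN)) i)
      rw [hsum] at hlt
      have h2 : ∑ i, w i = g.derivative.eval x + (∑ i, w i - g.derivative.eval x) := by ring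
      rw [h2, Valuation.map_add_eq_of_lt_left _ hlt]
  · refine (mem_listSum_ofFn_iff _ _).2
      ⟨fun i => (taylor e g).coeff i * (x - e) ^ (i : ℕ), fun i => ?_, ?_⟩
    · rw [hb, rv_mul, rv_pow]
    · rw [sum_coeff_taylor_mul_pow g e x (by omega), hgx, rv_zero]

/-- The Hensel conditions imply the existence of a root with leading term `ξ`. -/
theorem HenselConditions.exists_root [HenselianLocalRing O] {N : ℕ+} {d : ℕ} {ξ : RV O N}
    {a : Fin (d + 1) → K} (h : HenselConditions N ξ a) :
    ∃ y, ∑ i, a i * y ^ (i : ℕ) = 0 ∧ rv O N y = ξ := by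
  obtain ⟨⟨j, hj⟩, hξ, hder, ξ', hξ', h0⟩ := h
  obtain ⟨x, rfl⟩ := rv_surjective O (N ^ 2) ξ'
  rw [rvProj_rv] at hξ'
  subst hξ'
  have hx : x ≠ 0 := by simpa using hξ
  set P : K[X] := ∑ i : Fin (d + 1), C (a i) * X ^ (i : ℕ) with hP
  have hPe : ∀ y, P.eval y = ∑ i, a i * y ^ (i : ℕ) := by
    intro y
    simp [hP, eval_finsetSum]
  have hPc : ∀ i : Fin (d + 1), P.coeff i = a i := by
    intro i
    simp [hP, coeff_X_pow, Fin.val_inj]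
  have hPd : P.derivative.eval x = ∑ i : Fin d, ((i : ℕ) + 1 : ℕ) * a i.succ * x ^ (i : ℕ) := by
    simp only [hP, derivative_sum, eval_finsetSum]
    rw [Fin.sum_univ_succ]
    simp
    refine Finset.sum_congr rfl fun i _ => by ring
  obtain ⟨t, ht, ht1⟩ := exists_root_of_valuation_eval_one_lt O (rescale P 0 x) N (by
    intro k hk
    rw [derivative_rescale_eval_one, coeff_rescale, taylor_zero, sub_zero]
    by_cases hkd : k < d + 1
    · obtain ⟨k, rfl⟩ : ∃ j, k = j + 1 := ⟨k - 1, by omega⟩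
      have := hPc (Fin.succ ⟨k, by omega⟩)
      rw [Fin.val_succ] at this
      rw [this, map_mul, map_mul, map_pow, pow_succ', mul_left_comm, mul_assoc]
      refine mul_le_mul_right ?_ _
      have h1 := hder (rv O N (P.derivative.eval x)) ((mem_listSum_ofFn_iff _ _).2
        ⟨_, fun i => by rw [← rv_pow, ← rv_mul], by rw [hPd]⟩) ⟨k, by omega⟩
      simpa using h1
    · have : P.coeff k = 0 := by
        simp only [hP, finsetSum_coeff, coeff_C_mul, coeff_X_pow]
        refine Finset.sum_eq_zero fun i _ => ?_
        rw [if_neg (by omega), mul_zero]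
      simp [this]) (by
    -- Some representatives of the terms sum to exactly `0`. Hence `P(x)` is smaller than `|N|²`
    -- times the largest term.
    obtain ⟨w, hw, hw0⟩ := (mem_listSum_ofFn_iff _ _).1 h0
    rw [rv_eq_zero_iff] at hw0
    obtain ⟨k, -, hk⟩ := Finset.exists_max_image Finset.univ
      (fun i : Fin (d + 1) => O.valuation (a i * x ^ (i : ℕ))) ⟨j, Finset.mem_univ _⟩
    replace hk := fun i => hk i (Finset.mem_univ i)
    have hpos : 0 < O.valuation (a k * x ^ (k : ℕ)) :=
      ((Valuation.pos_iff _).2 (mul_ne_zero hj (pow_ne_zero _ hx))).trans_le (hk j)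
    have hwa : ∀ i, rv O (N ^ 2) (w i) = rv O (N ^ 2) (a i * x ^ (i : ℕ)) := by
      intro i
      rw [hw, rv_mul, rv_pow]
    have hlt := valuation_sum_sub_sum_lt O hwa
      (mul_pos hpos (valuation_pnat_pos O (N ^ 2))) (fun i => by
        rw [valuation_eq_of_rv_eq O (hwa i)]
        exact mul_le_mul_left (hk i) _)
    refine ⟨k, ?_⟩
    rw [hw0, sub_zero, ← hPe] at hlt
    rw [eval_rescale, coeff_rescale, taylor_zero, sub_zero, zero_add, mul_one, hPc]
    simpa using hlt)
  rw [eval_rescale, zero_add, sub_zero] at ht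
  refine ⟨x * t, by rw [← hPe, ht], ?_⟩
  refine (rv_eq_rv_of_valuation_sub_lt O ?_).symm
  have : x * t - x = (t - 1) * x := by ring
  rw [this, map_mul]
  exact mul_lt_mul_of_pos_right ht1 ((Valuation.pos_iff _).2 hx)

end LeadingTerm

/-! ### Maps between leading term structures that preserve finite diagrams. -/

namespace LeadingTerm

universe u v

open Polynomial Filter

variable {K : Type u} [Field K] {L : Type v} [Field L]

variable (OK : ValuationSubring K) (OL : ValuationSubring L) in
/-- Families of maps `RV_N(K) → RV_N(L)`. -/
abbrev RVMap : Type (max u v) := (N : ℕ+) → RV OK N → RV OL N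

variable {OK : ValuationSubring K} {OL : ValuationSubring L}

/-- Along the filter `l`, every finite part of the atomic diagram of `(RV_N(K))_N` is eventually
preserved. -/
structure IsEmbeddingAlong (l : Filter (RVMap OK OL)) : Prop where
  zero (N : ℕ+) : ∀ᶠ σ in l, σ N 0 = 0
  one (N : ℕ+) : ∀ᶠ σ in l, σ N 1 = 1
  mul (N : ℕ+) (ξ η : RV OK N) : ∀ᶠ σ in l, σ N (ξ * η) = σ N ξ * σ N η
  proj {N M : ℕ+} (h : N ∣ M) (ξ : RV OK M) :
    ∀ᶠ σ in l, σ N (rvProj OK h ξ) = rvProj OL h (σ M ξ)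
  eq_iff (N : ℕ+) (ξ η : RV OK N) : ∀ᶠ σ in l, (ξ = η ↔ σ N ξ = σ N η)
  dvd_iff (N : ℕ+) (ξ η : RV OK N) : ∀ᶠ σ in l, (RVDvd ξ η ↔ RVDvd (σ N ξ) (σ N η))
  oplus_iff (N : ℕ+) (ξ₁ ξ₂ ξ₃ : RV OK N) :
    ∀ᶠ σ in l, (OPlus ξ₁ ξ₂ ξ₃ ↔ OPlus (σ N ξ₁) (σ N ξ₂) (σ N ξ₃))
  hensel_iff (N d : ℕ+) (ξ : RV OK N) (ζ : Fin ((d : ℕ) + 1) → RV OK (N ^ 2)) :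
    ∀ᶠ σ in l, (HenselLift N ξ ζ ↔ HenselLift N (σ N ξ) fun i => σ (N ^ 2) (ζ i))

namespace IsEmbeddingAlong

variable {l : Filter (RVMap OK OL)} (hl : IsEmbeddingAlong l)

include hl

theorem pow (N : ℕ+) (ξ : RV OK N) (n : ℕ) : ∀ᶠ σ in l, σ N (ξ ^ n) = σ N ξ ^ n := by
  induction n with
  | zero => simpa using hl.one N
  | succ n ih =>
    filter_upwards [ih, hl.mul N (ξ ^ n) ξ] with σ h1 h2
    rw [pow_succ, h2, h1, pow_succ]

theorem rv_of_dvd {N M : ℕ+} (h : N ∣ M) (x : K) :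
    ∀ᶠ σ in l, ∀ y, rv OL M y = σ M (rv OK M x) → rv OL N y = σ N (rv OK N x) := by
  filter_upwards [hl.proj h (rv OK M x)] with σ hσ y hy
  rw [← rvProj_rv OL h, hy, ← hσ, rvProj_rv]

theorem list_sum_mem (N : ℕ+) (xs : List K) :
    ∀ᶠ σ in l, σ N (rv OK N xs.sum) ∈ listSum (xs.map fun x => σ N (rv OK N x)) := by
  induction xs with
  | nil => simpa [listSum] using hl.zero N
  | cons x xs ih =>
    filter_upwards [ih, hl.oplus_iff N (rv OK N x) (rv OK N xs.sum) (rv OK N (x + xs.sum))]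
      with σ h1 h2
    exact ⟨_, rfl, _, h1, by simpa using h2.1 ⟨x, xs.sum, _, rfl, rfl, rfl, rfl⟩⟩

theorem exists_sum (N : ℕ+) {n : ℕ} (x : Fin n → K) :
    ∀ᶠ σ in l, ∃ w : Fin n → L, (∀ i, rv OL N (w i) = σ N (rv OK N (x i))) ∧
      rv OL N (∑ i, w i) = σ N (rv OK N (∑ i, x i)) := by
  filter_upwards [hl.list_sum_mem N (List.ofFn x)] with σ hσ
  rw [List.map_ofFn, List.sum_ofFn] at hσ
  exact (mem_listSum_ofFn_iff _ _).1 hσ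

/-- Write `n` as a sum of `n` ones. At level `N * n`, any representatives of these ones sum to `n`
up to an error below `|N| |n|`, which fixes the leading term of `n` at level `N`. -/
theorem natCast [CharZero L] (N : ℕ+) (n : ℕ) :
    ∀ᶠ σ in l, rv OL N (n : L) = σ N (rv OK N (n : K)) := by
  rcases Nat.eq_zero_or_pos n with rfl | hn
  · filter_upwards [hl.zero N] with σ h
    simp [h]
  lift n to ℕ+ using hn
  set M : ℕ+ := N * n with hM
  have hMn : ((M : ℕ) : L) = (N : ℕ) * ((n : ℕ) : L) := by simp [hM]
  filter_upwards [hl.one M, hl.exists_sum M (fun _ : Fin n => (1 : K)),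
    hl.rv_of_dvd (Dvd.intro _ rfl : N ∣ M) (n : K)] with σ h1 ⟨w, hw, hws⟩ h2
  have hlt := valuation_sum_sub_sum_lt OL (N := M) (x := fun _ : Fin n => (1 : L)) (y := w)
    (fun i => by rw [hw, rv_one, rv_one, h1]) (valuation_pnat_pos OL M) (by simp)
  simp only [Finset.sum_const, Finset.card_univ, Fintype.card_fin, nsmul_eq_mul, mul_one] at hlt hws
  rw [hMn, map_mul] at hlt
  rw [rv_eq_rv_of_valuation_sub_lt OL hlt]
  exact h2 _ hws

theorem neg_one (N : ℕ+) : ∀ᶠ σ in l, rv OL N (-1) = σ N (rv OK N (-1)) := by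
  filter_upwards [hl.oplus_iff N (rv OK N 1) (rv OK N (-1)) (rv OK N 0), hl.one N, hl.zero N]
    with σ h h1 h0
  obtain ⟨x, y, z, hx, hy, hz, hxyz⟩ := h.1 ⟨1, -1, 0, rfl, rfl, rfl, by simp⟩
  rw [rv_zero, h0, rv_eq_zero_iff] at hz
  rw [rv_one, h1] at hx
  have : y = -1 * x := by linear_combination hxyz + hz
  rw [← hy, this, rv_mul, hx, mul_one]

theorem intCast [CharZero L] (N : ℕ+) (n : ℤ) :
    ∀ᶠ σ in l, rv OL N (n : L) = σ N (rv OK N (n : K)) := by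
  rcases Int.eq_nat_or_neg n with ⟨m, rfl | rfl⟩
  · simpa using hl.natCast N m
  · filter_upwards [hl.natCast N m, hl.neg_one N, hl.mul N (rv OK N (-1)) (rv OK N (m : K))]
      with σ h1 h2 h3
    have hK : ((-(m : ℤ) : ℤ) : K) = -1 * m := by push_cast; ring
    have hL : ((-(m : ℤ) : ℤ) : L) = -1 * m := by push_cast; ring
    rw [hK, hL, rv_mul, rv_mul, h1, h2, h3]

/-- A sum with bounded cancellation is compatible with the maps on leading terms. -/
theorem sum_of_le [CharZero K] [CharZero L] (M N : ℕ+) {n : ℕ} (x : Fin n → K)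
    (hx : ∀ i, OK.valuation (x i) * OK.valuation ((M : ℕ) : K) ≤ OK.valuation (∑ i, x i)) :
    ∀ᶠ σ in l, ∀ y : Fin n → L, (∀ i, rv OL (N * M) (y i) = σ (N * M) (rv OK (N * M) (x i))) →
      rv OL N (∑ i, y i) = σ N (rv OK N (∑ i, x i)) := by
  by_cases hs : ∑ i, x i = 0
  · have hx0 : ∀ i, x i = 0 := by
      intro i
      have := hx i
      rw [hs, map_zero, le_zero_iff, mul_eq_zero,
        or_iff_left (valuation_pnat_pos OK M).ne', map_eq_zero] at this
      exact this
    filter_upwards [hl.zero N, hl.zero (N * M)] with σ h0 h1 y hy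
    have hy0 : ∀ i, y i = 0 := by
      intro i
      have := hy i
      rwa [hx0, rv_zero, h1, rv_eq_zero_iff] at this
    simp [hs, hy0, h0]
  · set s := ∑ i, x i with hsdef
    -- The bound on cancellation is a divisibility of leading terms, so it passes to `L`.
    have hdvd : ∀ᶠ σ in l, ∀ i, RVDvd (σ (N * M) (rv OK (N * M) s))
        (σ (N * M) (rv OK (N * M) (x i) * rv OK (N * M) (M : ℕ))) := by
      rw [eventually_all]
      intro i
      filter_upwards [hl.dvd_iff (N * M) (rv OK (N * M) s)
        (rv OK (N * M) (x i) * rv OK (N * M) (M : ℕ))] with σ h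
      refine h.1 ?_
      rw [RVDvd, ← rv_mul, rvVal_rv, rvVal_rv, map_mul]
      exact hx i
    have hmul : ∀ᶠ σ in l, ∀ i, σ (N * M) (rv OK (N * M) (x i) * rv OK (N * M) (M : ℕ)) =
        σ (N * M) (rv OK (N * M) (x i)) * σ (N * M) (rv OK (N * M) (M : ℕ)) := by
      rw [eventually_all]
      exact fun i => hl.mul _ _ _
    filter_upwards [hdvd, hmul, hl.natCast (N * M) M, hl.exists_sum (N * M) x, hl.zero (N * M),
      hl.eq_iff (N * M) (rv OK (N * M) s) 0, hl.rv_of_dvd (Dvd.intro _ rfl : N ∣ N * M) s]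
      with σ hd hm hM ⟨w, hw, hws⟩ h0 hne hproj y hy
    have hw0 : ∑ i, w i ≠ 0 := by
      intro h
      rw [h, rv_zero, ← h0, eq_comm, ← hne, rv_eq_zero_iff] at hws
      exact hs hws
    have hpos := mul_pos (valuation_pnat_pos OL N) ((Valuation.pos_iff OL.valuation).2 hw0)
    -- Level `N * M` pays for both losses: `M` for the cancellation, `N` for the precision wanted of
    -- the sum.
    have hlt := valuation_sum_sub_sum_lt OL (fun i => (hw i).trans (hy i).symm) hpos (by
      intro i
      have h1 := hd i
      rw [hm, ← hws, ← hw, ← hM, ← rv_mul, RVDvd, rvVal_rv, rvVal_rv, map_mul] at h1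
      rw [PNat.mul_coe, Nat.cast_mul, map_mul, mul_left_comm]
      exact mul_le_mul_right h1 _)
    rw [← rv_eq_rv_of_valuation_sub_lt OL hlt]
    exact hproj _ hws

end IsEmbeddingAlong

end LeadingTerm

/-! ### Pseudo-division, closure under derivatives, generic Taylor coefficients. -/

namespace Polynomial

variable {R : Type*} [CommRing R]

/-- Pseudo-division with remainder. -/
theorem exists_C_leadingCoeff_pow_mul_eq (g : R[X]) (hg : 0 < g.natDegree) (f : R[X]) :
    ∃ (k : ℕ) (q r : R[X]), C g.leadingCoeff ^ k * f = q * g + r ∧ r.natDegree < g.natDegree := by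
  induction hn : f.natDegree using Nat.strong_induction_on generalizing f with
  | _ n ih =>
    by_cases hlt : f.natDegree < g.natDegree
    · exact ⟨0, 0, f, by simp, hlt⟩
    · have hle := not_lt.1 hlt
      have hdeg := natDegree_cancelLeads_lt_of_natDegree_le_natDegree hle (hg.trans_le hle)
      obtain ⟨k, q, r, h, hr⟩ := ih _ (hn ▸ hdeg) _ rfl
      refine ⟨k + 1, q + C g.leadingCoeff ^ k * (C f.leadingCoeff *
        X ^ (f.natDegree - g.natDegree)), r, ?_, hr⟩
      rw [cancelLeads, Nat.sub_eq_zero_of_le hle, pow_zero, mul_one] at h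
      linear_combination h

theorem exists_finset_derivative_closed (F : Finset R[X]) :
    ∃ G : Finset R[X], F ⊆ G ∧ (∀ f ∈ G, derivative f ∈ G) ∧
      ∀ n, (∀ f ∈ F, f.natDegree ≤ n) → ∀ f ∈ G, f.natDegree ≤ n := by
  classical
  refine ⟨F.biUnion fun f => (Finset.range (f.natDegree + 2)).image fun j => derivative^[j] f,
    ?_, ?_, ?_⟩
  · intro f hf
    simp only [Finset.mem_biUnion, Finset.mem_image, Finset.mem_range]
    exact ⟨f, hf, 0, by omega, rfl⟩
  · intro p hp
    simp only [Finset.mem_biUnion, Finset.mem_image, Finset.mem_range] at hp ⊢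
    obtain ⟨f, hf, j, hj, rfl⟩ := hp
    refine ⟨f, hf, ?_⟩
    by_cases hj' : j < f.natDegree + 1
    · exact ⟨j + 1, by omega, Function.iterate_succ_apply' _ _ _⟩
    · refine ⟨j, hj, ?_⟩
      rw [iterate_derivative_eq_zero (by omega), derivative_zero]
  · intro n hn p hp
    simp only [Finset.mem_biUnion, Finset.mem_image, Finset.mem_range] at hp
    obtain ⟨f, hf, j, -, rfl⟩ := hp
    exact (natDegree_iterate_derivative f j).trans ((Nat.sub_le _ _).trans (hn f hf))

/-- The coefficients of the expansion of `f` at a generic point `X`. -/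
noncomputable def taylorCoeff (f : R[X]) (i : ℕ) : R[X] := (taylor X (f.map C)).coeff i

theorem map_taylorCoeff {A : Type*} [CommRing A] (ψ : R[X] →+* A) (f : R[X]) (i : ℕ) :
    ψ (taylorCoeff f i) = (taylor (ψ X) (f.map (ψ.comp C))).coeff i := by
  rw [taylorCoeff, ← coeff_map, map_taylor, map_map]

theorem eval₂_taylorCoeff {A : Type*} [CommRing A] (φ : R →+* A) (e : A) (f : R[X]) (i : ℕ) :
    (taylorCoeff f i).eval₂ φ e = (taylor e (f.map φ)).coeff i := by
  have h := map_taylorCoeff (eval₂RingHom φ e) f i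
  have h1 : (eval₂RingHom φ e).comp C = φ := by ext; simp
  rwa [h1, coe_eval₂RingHom, eval₂_X] at h

end Polynomial

/-! ### Approximable homomorphisms. -/

namespace LeadingTerm

universe u v

open Polynomial Filter

variable {K : Type u} [Field K] {L : Type v} [Field L]
  {OK : ValuationSubring K} {OL : ValuationSubring L} {l : Filter (RVMap OK OL)}
  {R : Type*} [CommRing R] {φ : R →+* K}

variable (l) in
/-- The homomorphism `φ : R → K` is approximable if, along `l`, there are homomorphisms `R → L`
whose leading terms at finitely many given elements correspond to those of `φ`. -/
def Approximable (φ : R →+* K) : Prop :=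
  ∀ T : Finset (R × ℕ+), ∀ᶠ σ in l, ∃ ψ : R →+* L,
    ∀ p ∈ T, rv OL p.2 (ψ p.1) = σ p.2 (rv OK p.2 (φ p.1))

theorem Approximable.comp {S : Type*} [CommRing S] (h : Approximable l φ) (θ : S →+* R) :
    Approximable l (φ.comp θ) := by
  classical
  intro T
  filter_upwards [h (T.image fun p => (θ p.1, p.2))] with σ ⟨ψ, hψ⟩
  exact ⟨ψ.comp θ, fun p hp => hψ _ (Finset.mem_image_of_mem _ hp)⟩

/-- One of the closest roots may serve as centre for all polynomials of a given finite set. -/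
theorem exists_center [CharZero K] [HenselianLocalRing OK] (hφ : Approximable l φ) (F : Finset R[X])
    (hF : ∀ f ∈ F, derivative f ∈ F) (x : K)
    (hroot : ∀ e, ∀ f ∈ F, f.map φ ≠ 0 → (f.map φ).eval e = 0 →
      Approximable l (eval₂RingHom φ e)) :
    ∃ (e : K) (M : ℕ+), Approximable l (eval₂RingHom φ e) ∧
      ∀ f ∈ F, NoCancellation OK M (f.map φ) e x := by
  classical
  obtain ⟨e, M, he, hM⟩ := exists_root_noCancellation (O := OK) (F.image (map φ)) (by
    intro p hp
    obtain ⟨f, hf, rfl⟩ := Finset.mem_image.1 hp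
    rw [derivative_map]
    exact Finset.mem_image_of_mem _ (hF f hf)) x
  refine ⟨e, M, ?_, fun f hf => hM _ (Finset.mem_image_of_mem _ hf)⟩
  rcases he with rfl | ⟨p, hp, hp0, hpe⟩
  · convert hφ.comp (evalRingHom 0)
    ext <;> simp
  · obtain ⟨f, hf, rfl⟩ := Finset.mem_image.1 hp
    exact hroot e f hf hp0 hpe

variable (hl : IsEmbeddingAlong l)

include hl

/-- Agreement at a level implies agreement at its divisors, so the product of the finitely many
levels serves for all. -/
theorem approximable_of_forall_finset
    (h : ∀ (F : Finset R) (N : ℕ+), ∀ᶠ σ in l, ∃ ψ : R →+* L,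
      ∀ f ∈ F, rv OL N (ψ f) = σ N (rv OK N (φ f))) : Approximable l φ := by
  classical
  intro T
  have hproj : ∀ᶠ σ in l, ∀ p ∈ T, ∀ y, rv OL (∏ p ∈ T, p.2) y =
      σ (∏ p ∈ T, p.2) (rv OK (∏ p ∈ T, p.2) (φ p.1)) →
      rv OL p.2 y = σ p.2 (rv OK p.2 (φ p.1)) := by
    rw [Filter.eventually_all_finset]
    exact fun p hp => hl.rv_of_dvd (Finset.dvd_prod_of_mem _ hp) _
  filter_upwards [h (T.image Prod.fst) (∏ p ∈ T, p.2), hproj] with σ ⟨ψ, hψ⟩ hσ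
  exact ⟨ψ, fun p hp => hσ p hp _ (hψ _ (Finset.mem_image_of_mem _ hp))⟩

theorem approximable_intCast [CharZero L] : Approximable l (Int.castRingHom K) := by
  refine approximable_of_forall_finset hl fun F N => ?_
  have : ∀ᶠ σ in l, ∀ n ∈ F, rv OL N (n : L) = σ N (rv OK N (n : K)) := by
    rw [Filter.eventually_all_finset]
    exact fun n _ => hl.intCast N n
  filter_upwards [this] with σ hσ
  exact ⟨Int.castRingHom L, fun n hn => by simpa using hσ n hn⟩

section CharZero

variable [CharZero K] [CharZero L]

/-- Here `ψ X` plays the part of `e` in `L`, and `y` that of `x - e`. The expansion at `e` has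
bounded cancellation, so `sum_of_le` applies to its terms. -/
theorem rv_eval₂_of_noCancellation (f : R[X]) {e x : K} {M : ℕ+}
    (hf : NoCancellation OK M (f.map φ) e x) (N : ℕ+) :
    ∀ᶠ σ in l, ∀ (ψ : R[X] →+* L) (y : L),
      (∀ i ≤ f.natDegree, rv OL (N * M) (ψ (taylorCoeff f i)) =
        σ (N * M) (rv OK (N * M) ((taylorCoeff f i).eval₂ φ e))) →
      rv OL (N * M) y = σ (N * M) (rv OK (N * M) (x - e)) →
      rv OL N (f.eval₂ (ψ.comp C) (ψ X + y)) = σ N (rv OK N (f.eval₂ φ x)) := by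
  set n := f.natDegree + 1 with hn
  set u : Fin n → K := fun i => (taylor e (f.map φ)).coeff i * (x - e) ^ (i : ℕ) with hu
  have hsum : ∑ i, u i = f.eval₂ φ x := by
    rw [hu, sum_coeff_taylor_mul_pow _ _ _ (Nat.lt_succ_of_le (natDegree_map_le)), eval_map]
  have hmul : ∀ᶠ σ in l, ∀ i : Fin n, σ (N * M) (rv OK (N * M) (u i)) =
      σ (N * M) (rv OK (N * M) ((taylor e (f.map φ)).coeff i)) *
        σ (N * M) (rv OK (N * M) (x - e)) ^ (i : ℕ) := by
    rw [eventually_all]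
    intro i
    filter_upwards [hl.mul (N * M) (rv OK (N * M) ((taylor e (f.map φ)).coeff i))
      (rv OK (N * M) (x - e) ^ (i : ℕ)), hl.pow (N * M) (rv OK (N * M) (x - e)) i] with σ h1 h2
    rw [hu, rv_mul, rv_pow, h1, h2]
  filter_upwards [hmul, hl.sum_of_le M N u (fun i => by
    rw [hsum, hu, map_mul, map_pow, ← eval_map]
    exact hf i)] with σ h1 h2 ψ y hψ hy
  have hsumL : ∑ i : Fin n, ψ (taylorCoeff f i) * y ^ (i : ℕ) =
      f.eval₂ (ψ.comp C) (ψ X + y) := by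
    have := sum_coeff_taylor_mul_pow (f.map (ψ.comp C)) (ψ X) (ψ X + y)
      (Nat.lt_succ_of_le natDegree_map_le : _ < n)
    simpa [map_taylorCoeff, eval_map] using this
  rw [← hsumL, ← hsum]
  refine h2 _ fun i => ?_
  rw [h1, rv_mul, rv_pow, hψ i (by omega), hy, eval₂_taylorCoeff]

theorem eventually_rv_eval₂ (F : Finset R[X]) {e x : K} {M : ℕ+}
    (hf : ∀ f ∈ F, NoCancellation OK M (f.map φ) e x) (N : ℕ+) :
    ∀ᶠ σ in l, ∀ (ψ : R[X] →+* L) (y : L),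
      (∀ f ∈ F, ∀ i ≤ f.natDegree, rv OL (N * M) (ψ (taylorCoeff f i)) =
        σ (N * M) (rv OK (N * M) ((taylorCoeff f i).eval₂ φ e))) →
      rv OL (N * M) y = σ (N * M) (rv OK (N * M) (x - e)) →
      ∀ f ∈ F, rv OL N (f.eval₂ (ψ.comp C) (ψ X + y)) = σ N (rv OK N (f.eval₂ φ x)) := by
  have : ∀ᶠ σ in l, ∀ f ∈ F, ∀ (ψ : R[X] →+* L) (y : L),
      (∀ i ≤ f.natDegree, rv OL (N * M) (ψ (taylorCoeff f i)) =
        σ (N * M) (rv OK (N * M) ((taylorCoeff f i).eval₂ φ e))) →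
      rv OL (N * M) y = σ (N * M) (rv OK (N * M) (x - e)) →
      rv OL N (f.eval₂ (ψ.comp C) (ψ X + y)) = σ N (rv OK N (f.eval₂ φ x)) := by
    rw [Filter.eventually_all_finset]
    exact fun f hfF => rv_eval₂_of_noCancellation hl f (hf f hfF) N
  filter_upwards [this] with σ hσ ψ y hψ hy f hfF
  exact hσ f hfF ψ y (hψ f hfF) hy

end CharZero

end LeadingTerm

/-! ### Adjoining one element. -/

namespace LeadingTerm

universe u v

open Polynomial Filter

variable {K : Type u} [Field K] {L : Type v} [Field L]
  {OK : ValuationSubring K} {OL : ValuationSubring L} {l : Filter (RVMap OK OL)}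
  {R : Type*} [CommRing R] {φ : R →+* K} [CharZero K] [CharZero L]

/-- The finite set of data on which approximations at a centre are tested. -/
theorem exists_finset_taylorCoeff (F : Finset R[X]) (N : ℕ+) :
    ∃ T : Finset (R[X] × ℕ+), ∀ f ∈ F, ∀ i ≤ f.natDegree, (taylorCoeff f i, N) ∈ T := by
  classical
  refine ⟨F.biUnion fun f => (Finset.range (f.natDegree + 1)).image fun i => (taylorCoeff f i, N),
    fun f hf i hi => Finset.mem_biUnion.2 ⟨f, hf, Finset.mem_image.2 ⟨i, ?_, rfl⟩⟩⟩
  exact Finset.mem_range.2 (by omega)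

/-- The Hensel lift predicate transfers approximate roots: if `g(x) = 0` and `g'` has no
cancellation, then good approximations at the centre `e` yield a root in `L`. -/
theorem exists_root_of_noCancellation [HenselianLocalRing OL] (hl : IsEmbeddingAlong l)
    {g : R[X]} (hg0 : 0 < g.natDegree) (hgd : g.natDegree = (g.map φ).natDegree) {e x : K}
    (hgx : (g.map φ).eval x = 0) (hxe : x ≠ e) {M N : ℕ+}
    (hM : NoCancellation OK M (derivative (g.map φ)) e x)
    (hN : (M : ℕ) * g.natDegree.factorial ∣ N) :
    ∀ᶠ σ in l, ∀ ψ : R[X] →+* L,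
      (∀ i ≤ g.natDegree, rv OL (N ^ 2) (ψ (taylorCoeff g i)) =
        σ (N ^ 2) (rv OK (N ^ 2) ((taylorCoeff g i).eval₂ φ e))) →
      ∃ y, g.eval₂ (ψ.comp C) (ψ X + y) = 0 ∧ rv OL N y = σ N (rv OK N (x - e)) := by
  obtain ⟨d, hd⟩ : ∃ d : ℕ+, (d : ℕ) = g.natDegree := ⟨⟨_, hg0⟩, rfl⟩
  have hne : g.map φ ≠ 0 := by
    intro h
    rw [h, natDegree_zero] at hgd
    omega
  have hlift : HenselLift (O := OK) N (rv OK N (x - e))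
      (fun i : Fin ((d : ℕ) + 1) => rv OK (N ^ 2) ((taylor e (g.map φ)).coeff i)) := fun b hb =>
    henselConditions_of_noCancellation (by rw [hd, hgd]) hne hgx hxe hM (hgd ▸ hN) b hb
  filter_upwards [hl.hensel_iff N d _ _] with σ hσ ψ hψ
  obtain ⟨y, hy0, hy⟩ := (hσ.1 hlift (fun i => ψ (taylorCoeff g i)) (fun i => by
    rw [hψ i (by omega), eval₂_taylorCoeff])).exists_root
  refine ⟨y, ?_, hy⟩
  have := sum_coeff_taylor_mul_pow (f := g.map (ψ.comp C)) (e := ψ X) (x := ψ X + y)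
    (n := d + 1) (Nat.lt_succ_of_le (natDegree_map_le.trans hd.ge))
  rw [← eval_map, ← this, ← hy0]
  simp [map_taylorCoeff]

variable [HenselianLocalRing OK] [HenselianLocalRing OL] (hl : IsEmbeddingAlong l)

include hl

/-- Approximability extends to the roots of polynomials. -/
theorem Approximable.adjoin_root
    (hφ : Approximable l φ) {x : K} {g : R[X]} (hg : g.map φ ≠ 0) (hgx : (g.map φ).eval x = 0) :
    Approximable l (eval₂RingHom φ x) := by
  classical
  induction hd : (g.map φ).natDegree using Nat.strong_induction_on generalizing x g with
  | _ d ih =>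
  subst hd
  -- Replacing `g` by a lift of the same degree as its image ensures that `φ` does not kill the
  -- leading coefficient; this allows its powers to be cancelled after pseudo-division.
  obtain ⟨g', hg', hgd⟩ := exists_natDegree_eq_of_mem_lifts ((mem_lifts (f := φ) _).2 ⟨g, rfl⟩)
  rw [← hg'] at hg hgx ih hgd
  clear hg' g
  rename' g' => g
  have hg0 : 0 < g.natDegree := by
    rw [hgd]
    exact natDegree_pos_of_eval₂_root hg (RingHom.id K) hgx fun _ h => h
  refine approximable_of_forall_finset hl fun F N => ?_
  choose k q r hqr hr using exists_C_leadingCoeff_pow_mul_eq g hg0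
  -- The derivative of `g` is included for the Hensel conditions, the remainders for the values at
  -- `x`. All have degree below that of `g`, so the induction covers their roots.
  obtain ⟨G, hFG, hG, hGd⟩ := exists_finset_derivative_closed (insert (derivative g) (F.image r))
  replace hGd := hGd (g.natDegree - 1) (by
    simp only [Finset.mem_insert, Finset.mem_image]
    rintro f (rfl | ⟨f, -, rfl⟩)
    · exact natDegree_derivative_le g
    · exact Nat.le_sub_one_of_lt (hr f))
  obtain ⟨e, M, he, hM⟩ := exists_center hφ G hG x fun e f hf hf0 hfe =>
    ih _ (by
      rw [← hgd]
      exact natDegree_map_le.trans_lt ((hGd f hf).trans_lt (by omega))) hf0 hfe rfl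
  by_cases hxe : x = e
  · subst hxe
    filter_upwards [he (F.image fun f => (f, N))] with σ ⟨ψ, hψ⟩
    exact ⟨ψ, fun f hf => hψ _ (Finset.mem_image_of_mem _ hf)⟩
  have hMg : NoCancellation OK M (derivative (g.map φ)) e x := by
    rw [derivative_map]
    exact hM _ (hFG (Finset.mem_insert_self _ _))
  obtain ⟨c, hc⟩ : ∃ c : ℕ+, (c : ℕ) = g.natDegree.factorial :=
    ⟨⟨_, g.natDegree.factorial_pos⟩, rfl⟩
  -- The factor `M * c` serves the Hensel conditions, and `N * M` is the precision of `x - e` needed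
  -- in the expansions.
  set N' : ℕ+ := N * M * c with hN'
  have hN'M : (M : ℕ) * g.natDegree.factorial ∣ N' :=
    ⟨N, by rw [← hc, hN', PNat.mul_coe, PNat.mul_coe]; ring⟩
  obtain ⟨T₁, hT₁⟩ := exists_finset_taylorCoeff G (N * M)
  obtain ⟨T₂, hT₂⟩ := exists_finset_taylorCoeff {g} (N' ^ 2)
  have hmul : ∀ᶠ σ in l, ∀ f ∈ F,
      σ N (rv OK N (φ g.leadingCoeff) ^ k f * rv OK N (f.eval₂ φ x)) =
        σ N (rv OK N (φ g.leadingCoeff)) ^ k f * σ N (rv OK N (f.eval₂ φ x)) := by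
    rw [Filter.eventually_all_finset]
    intro f _
    filter_upwards [hl.pow N (rv OK N (φ g.leadingCoeff)) (k f),
      hl.mul N (rv OK N (φ g.leadingCoeff) ^ k f) (rv OK N (f.eval₂ φ x))] with σ h1 h2
    rw [h2, h1]
  filter_upwards [he (T₁ ∪ T₂ ∪ {(C g.leadingCoeff, N)}), eventually_rv_eval₂ hl G hM N,
    exists_root_of_noCancellation hl hg0 hgd hgx hxe hMg hN'M, hmul, hl.zero N,
    hl.eq_iff N (rv OK N (φ g.leadingCoeff)) 0,
    hl.rv_of_dvd (Dvd.intro _ rfl : N * M ∣ N') (x - e)] with σ ⟨ψ, hψ⟩ hσ hroot hm h0 hlc hproj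
  obtain ⟨y, hy0, hy⟩ := hroot ψ fun i hi => hψ _ (by
    simp only [Finset.mem_union]
    exact Or.inl (Or.inr (hT₂ g (Finset.mem_singleton_self g) i hi)))
  refine ⟨eval₂RingHom (ψ.comp C) (ψ X + y), fun f hf => ?_⟩
  have hrf := hσ ψ y (fun f hf i hi => hψ _ (by
    simp only [Finset.mem_union]
    exact Or.inl (Or.inl (hT₁ f hf i hi)))) (hproj y hy) (r f)
    (hFG (Finset.mem_insert_of_mem (Finset.mem_image_of_mem r hf)))
  have hc := hψ (C g.leadingCoeff, N) (by simp)
  simp only [coe_eval₂RingHom, eval₂_C] at hc ⊢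
  have hL : ψ (C g.leadingCoeff) ^ k f * f.eval₂ (ψ.comp C) (ψ X + y) =
      (r f).eval₂ (ψ.comp C) (ψ X + y) := by
    have := congrArg (eval₂ (ψ.comp C) (ψ X + y)) (hqr f)
    simpa [eval₂_mul, eval₂_add, eval₂_pow, hy0] using this
  have hK : φ g.leadingCoeff ^ k f * f.eval₂ φ x = (r f).eval₂ φ x := by
    have := congrArg (eval₂ φ x) (hqr f)
    rw [eval_map] at hgx
    simpa [eval₂_mul, eval₂_add, eval₂_pow, hgx] using this
  rw [← hL, ← hK, rv_mul, rv_mul, rv_pow, rv_pow, hm f hf, hc] at hrf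
  refine mul_left_cancel₀ (pow_ne_zero _ ?_) hrf
  rw [← h0, ne_eq, ← hlc, rv_eq_zero_iff, leadingCoeff, hgd, ← coeff_map]
  exact leadingCoeff_ne_zero.2 hg

/-- Approximability extends to arbitrary elements. -/
theorem Approximable.adjoin
    (hφ : Approximable l φ) (x : K) : Approximable l (eval₂RingHom φ x) := by
  refine approximable_of_forall_finset hl fun F N => ?_
  obtain ⟨G, hFG, hG, -⟩ := exists_finset_derivative_closed F
  obtain ⟨e, M, he, hM⟩ := exists_center hφ G hG x fun e f _ hf hfe => hφ.adjoin_root hl hf hfe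
  obtain ⟨T, hT⟩ := exists_finset_taylorCoeff G (N * M)
  filter_upwards [he T, eventually_rv_eval₂ hl G hM N] with σ ⟨ψ, hψ⟩ hσ
  obtain ⟨y, hy⟩ := rv_surjective OL (N * M) (σ (N * M) (rv OK (N * M) (x - e)))
  exact ⟨eval₂RingHom (ψ.comp C) (ψ X + y), fun f hf =>
    hσ ψ y (fun f hf i hi => hψ _ (hT f hf i hi)) hy f (hFG hf)⟩

end LeadingTerm

/-! ### Restriction of languages and the filter of finite diagrams. -/

namespace ManySorted

universe u v

variable {S : Type} {Λ : Signature S}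

/-! ### Extending a language to more sorts -/

section Restrict

variable {S' : Type} {ι : S' → S}

/-- A term of the restricted signature, seen as a term of the full one. -/
def Term.ofRestrict {k : ℕ} {τ : Fin k → S'} :
    {s : S'} → Term (Λ.restrict ι) τ s → Term Λ (fun i => ι (τ i)) (ι s)
  | _, .var i => .var i
  | _, .app f t => .app (Λ := Λ) f fun i => (t i).ofRestrict

/-- A formula of the restricted signature, seen as a formula of the full one. -/
def QFFormula.ofRestrict {k : ℕ} {τ : Fin k → S'} :
    QFFormula (Λ.restrict ι) τ → QFFormula Λ (fun i => ι (τ i))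
  | .falsum => .falsum
  | .equal t₁ t₂ => .equal t₁.ofRestrict t₂.ofRestrict
  | .rel R t => .rel (Λ := Λ) R fun i => (t i).ofRestrict
  | .not φ => .not φ.ofRestrict
  | .and φ ψ => .and φ.ofRestrict ψ.ofRestrict
  | .or φ ψ => .or φ.ofRestrict ψ.ofRestrict

theorem Term.eval_ofRestrict (M : Str.{u} Λ) {k : ℕ} {τ : Fin k → S'}
    (y : (i : Fin k) → M.Carrier (ι (τ i))) {s : S'} (t : Term (Λ.restrict ι) τ s) :
    t.ofRestrict.eval M y = t.eval (M.restrict ι) y := by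
  induction t with
  | var i => rfl
  | app f t ih =>
    simp only [Term.ofRestrict, Term.eval, ih]
    rfl

theorem QFFormula.realize_ofRestrict (M : Str.{u} Λ) {k : ℕ} {τ : Fin k → S'}
    (y : (i : Fin k) → M.Carrier (ι (τ i))) (φ : QFFormula (Λ.restrict ι) τ) :
    φ.ofRestrict.Realize M y ↔ φ.Realize (M.restrict ι) y := by
  induction φ with
  | falsum => rfl
  | equal t₁ t₂ =>
    simp only [QFFormula.ofRestrict, QFFormula.Realize, Term.eval_ofRestrict]
    rfl
  | rel R t =>
    simp only [QFFormula.ofRestrict, QFFormula.Realize, Term.eval_ofRestrict]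
    rfl
  | not φ ih => simp only [QFFormula.ofRestrict, QFFormula.Realize, ih]
  | and φ ψ ih₁ ih₂ => simp only [QFFormula.ofRestrict, QFFormula.Realize, ih₁, ih₂]
  | or φ ψ ih₁ ih₂ => simp only [QFFormula.ofRestrict, QFFormula.Realize, ih₁, ih₂]

theorem Str.Models.restrict {M : Str.{u} Λ} {N : Str.{v} Λ} (h : N.Models M.existentialTheory)
    (ι : S' → S) : (N.restrict ι).Models (M.restrict ι).existentialTheory := by
  rintro ⟨k, τ, φ⟩ ⟨y, hy⟩
  obtain ⟨z, hz⟩ := h ⟨k, fun i => ι (τ i), φ.ofRestrict⟩ ⟨y, (φ.realize_ofRestrict M y).2 hy⟩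
  exact ⟨z, (QFFormula.realize_ofRestrict (τ := τ) N z φ).1 hz⟩

end Restrict

/-! ### The filter of partial embeddings -/

variable {M : Str.{u} Λ} {N : Str.{v} Λ}

variable (M N) in
/-- A property of families of maps `M → N` is forced by the diagram of `M` if it follows from the
preservation of one quantifier-free formula in finitely many elements of `M`. -/
def ForcedByDiagram (P : Set ((s : S) → M.Carrier s → N.Carrier s)) : Prop :=
  ∃ E : Finset (Σ s, M.Carrier s), ∀ (k : ℕ) (τ : Fin k → S) (a : (i : Fin k) → M.Carrier (τ i)),
    (∀ p ∈ E, ∃ i, (⟨τ i, a i⟩ : Σ s, M.Carrier s) = p) →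
    ∃ φ : QFFormula Λ τ, φ.Realize M a ∧ ∀ σ, φ.Realize N (fun i => σ _ (a i)) → σ ∈ P

variable (M N) in
/-- The filter of all properties forced by the diagram. -/
def diagramFilter : Filter ((s : S) → M.Carrier s → N.Carrier s) where
  sets := {P | ForcedByDiagram M N P}
  univ_sets := ⟨∅, fun _ _ _ _ => ⟨.not .falsum, fun h => h, fun _ _ => trivial⟩⟩
  sets_of_superset := fun ⟨E, hE⟩ hPQ => ⟨E, fun k τ a ha =>
    let ⟨φ, h1, h2⟩ := hE k τ a ha
    ⟨φ, h1, fun σ hσ => hPQ (h2 σ hσ)⟩⟩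
  inter_sets := by
    classical
    rintro P Q ⟨E, hE⟩ ⟨F, hF⟩
    refine ⟨E ∪ F, fun k τ a ha => ?_⟩
    -- Every tuple covering the finite set admits a formula, so both formulas can be taken in the
    -- same variables and no renaming is needed.
    obtain ⟨φ, h1, h2⟩ := hE k τ a fun p hp => ha p (Finset.mem_union_left _ hp)
    obtain ⟨ψ, h3, h4⟩ := hF k τ a fun p hp => ha p (Finset.mem_union_right _ hp)
    exact ⟨.and φ ψ, ⟨h1, h3⟩, fun σ hσ => ⟨h2 σ hσ.1, h4 σ hσ.2⟩⟩

theorem exists_map_extending [∀ s, Nonempty (N.Carrier s)] {k : ℕ} {τ : Fin k → S}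
    (a : (i : Fin k) → M.Carrier (τ i)) (b : (i : Fin k) → N.Carrier (τ i))
    (ha : Function.Injective fun i => (⟨τ i, a i⟩ : Σ s, M.Carrier s)) :
    ∃ σ : (s : S) → M.Carrier s → N.Carrier s, ∀ i, σ _ (a i) = b i := by
  have : ∀ p : Σ s, M.Carrier s, ∃ y : N.Carrier p.1,
      ∀ i, (⟨τ i, a i⟩ : Σ s, M.Carrier s) = p → HEq y (b i) := by
    intro p
    by_cases hp : ∃ i, (⟨τ i, a i⟩ : Σ s, M.Carrier s) = p
    · obtain ⟨i, rfl⟩ := hp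
      refine ⟨b i, fun j hj => ?_⟩
      obtain rfl := ha hj
      exact HEq.rfl
    · exact ⟨Classical.arbitrary _, fun i hi => absurd ⟨i, hi⟩ hp⟩
  choose y hy using this
  exact ⟨fun s x => y ⟨s, x⟩, fun i => eq_of_heq (hy _ i rfl)⟩

/-- If the empty property were forced, some formula true in `M` at an enumeration of `E` would have
no realization through a map. But its existential closure holds in `N`, and a repetition-free
enumeration lets any witness extend to a family of maps. -/
theorem diagramFilter_neBot [∀ s, Nonempty (N.Carrier s)] (h : N.Models M.existentialTheory) :
    (diagramFilter M N).NeBot := by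
  refine ⟨fun hbot => ?_⟩
  obtain ⟨E, hE⟩ := Filter.empty_mem_iff_bot.2 hbot
  set e := E.equivFin
  obtain ⟨φ, h1, h2⟩ := hE E.card (fun i => (e.symm i).1.1) (fun i => (e.symm i).1.2)
    (fun p hp => ⟨e ⟨p, hp⟩, by simp⟩)
  obtain ⟨b, hb⟩ := h ⟨_, _, φ⟩ ⟨_, h1⟩
  obtain ⟨σ, hσ⟩ := exists_map_extending (N := N) (fun i => (e.symm i).1.2) b
    (fun i j hij => e.symm.injective (Subtype.ext hij))
  exact h2 σ (by simpa only [hσ] using hb)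

theorem exists_term_eval_eq {k : ℕ} {τ : Fin k → S} {a : (i : Fin k) → M.Carrier (τ i)} {s : S}
    {x : M.Carrier s} (h : ∃ i, (⟨τ i, a i⟩ : Σ s, M.Carrier s) = ⟨s, x⟩) :
    ∃ t : Term Λ τ s, t.eval M a = x ∧
      ∀ σ : (s : S) → M.Carrier s → N.Carrier s, t.eval N (fun i => σ _ (a i)) = σ s x := by
  obtain ⟨i, h⟩ := h
  cases h
  exact ⟨.var i, rfl, fun _ => rfl⟩

theorem eventually_map_funMap {n : ℕ} {τ : Fin n → S} {s : S} (f : Λ.Functions n τ s)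
    (x : (i : Fin n) → M.Carrier (τ i)) :
    ∀ᶠ σ in diagramFilter M N, σ s (M.funMap f x) = N.funMap f fun i => σ _ (x i) := by
  classical
  refine ⟨insert ⟨s, M.funMap f x⟩ (Finset.univ.image fun i => ⟨τ i, x i⟩), fun k τ a ha => ?_⟩
  obtain ⟨t₀, h0, h0'⟩ := exists_term_eval_eq (N := N) (ha _ (Finset.mem_insert_self _ _))
  choose t ht ht' using fun i => exists_term_eval_eq (N := N)
    (ha _ (Finset.mem_insert_of_mem (Finset.mem_image_of_mem _ (Finset.mem_univ i))))
  refine ⟨.equal t₀ (.app f t), ?_, fun σ hσ => ?_⟩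
  · simp only [QFFormula.Realize, Term.eval, h0, ht]
  · simp only [QFFormula.Realize, Term.eval, h0', ht'] at hσ
    exact hσ

theorem eventually_relMap_iff {n : ℕ} {τ : Fin n → S} (R : Λ.Relations n τ)
    (x : (i : Fin n) → M.Carrier (τ i)) :
    ∀ᶠ σ in diagramFilter M N, (M.relMap R x ↔ N.relMap R fun i => σ _ (x i)) := by
  classical
  refine ⟨Finset.univ.image fun i => ⟨τ i, x i⟩, fun k τ a ha => ?_⟩
  choose t ht ht' using fun i => exists_term_eval_eq (N := N)
    (ha _ (Finset.mem_image_of_mem _ (Finset.mem_univ i)))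
  by_cases hR : M.relMap R x
  · refine ⟨.rel R t, ?_, fun σ hσ => ?_⟩
    · simpa only [QFFormula.Realize, ht] using hR
    · refine iff_of_true hR ?_
      simpa only [QFFormula.Realize, ht'] using hσ
  · refine ⟨.not (.rel R t), ?_, fun σ hσ => ?_⟩
    · simpa only [QFFormula.Realize, ht] using hR
    · refine iff_of_false hR ?_
      simpa only [QFFormula.Realize, ht'] using hσ

theorem eventually_eq_iff {s : S} (x y : M.Carrier s) :
    ∀ᶠ σ in diagramFilter M N, (x = y ↔ σ s x = σ s y) := by
  classical
  by_cases hxy : x = y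
  · simp [hxy]
  · refine ⟨{⟨s, x⟩, ⟨s, y⟩}, fun k τ a ha => ?_⟩
    obtain ⟨t, ht, ht'⟩ := exists_term_eval_eq (N := N) (ha ⟨s, x⟩ (by simp))
    obtain ⟨r, hr, hr'⟩ := exists_term_eval_eq (N := N) (ha ⟨s, y⟩ (by simp))
    refine ⟨.not (.equal t r), ?_, fun σ hσ => iff_of_false hxy ?_⟩
    · simpa only [QFFormula.Realize, ht, hr] using hxy
    · simpa only [QFFormula.Realize, ht', hr'] using hσ

end ManySorted

/-! ### The filter for leading term structures. -/

namespace LRV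

open LeadingTerm ManySorted Filter

universe u v

variable {K : Type u} [Field K] {L : Type v} [Field L]
  {OK : ValuationSubring K} {OL : ValuationSubring L}

variable (OK OL) in
/-- The filter of partial embeddings of `(RV_N(K))_N` into `(RV_N(L))_N`. -/
noncomputable def rvFilter : Filter (RVMap OK OL) := diagramFilter (strRV OK) (strRV OL)

theorem rvFilter_neBot (h : (strRV OL).Models (strRV OK).existentialTheory) :
    (rvFilter OK OL).NeBot := by
  have : ∀ s, Nonempty ((strRV OL).Carrier s) := fun N => ⟨(0 : RV OL N)⟩
  exact diagramFilter_neBot h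

theorem isEmbeddingAlong_rvFilter : IsEmbeddingAlong (rvFilter OK OL) where
  zero N := eventually_map_funMap (M := strRV OK) (N := strRV OL) (τ := fun _ => N) (s := N)
    (Fun.zeroRV N) Fin.elim0
  one N := by
    have := eventually_map_funMap (M := strRV OK) (N := strRV OL) (τ := fun _ => N) (s := N)
      (Fun.oneRV N) Fin.elim0
    rw [← rv_one OK N, ← rv_one OL N]
    exact this
  mul N ξ η := eventually_map_funMap (M := strRV OK) (N := strRV OL) (τ := fun _ => N) (s := N)
    (Fun.mulRV N) ![ξ, η]
  proj {N M} h ξ := eventually_map_funMap (M := strRV OK) (N := strRV OL) (τ := fun _ => M)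
    (s := N) (Fun.rvProj N M h) ![ξ]
  eq_iff N ξ η := eventually_eq_iff (M := strRV OK) (N := strRV OL) (s := N) ξ η
  dvd_iff N ξ η := eventually_relMap_iff (M := strRV OK) (N := strRV OL) (τ := fun _ => N)
    (Rel.div N) ![ξ, η]
  oplus_iff N ξ₁ ξ₂ ξ₃ := eventually_relMap_iff (M := strRV OK) (N := strRV OL) (τ := fun _ => N)
    (Rel.oplus N) ![ξ₁, ξ₂, ξ₃]
  hensel_iff N d ξ ζ := eventually_relMap_iff (M := strRV OK) (N := strRV OL)
    (τ := henselIndex N d) (Rel.hensel N d)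
    (Fin.cons (α := fun i => RV OK (henselIndex N d i)) ξ ζ)

end LRV

/-! ### Evaluation of integer polynomials is approximable. -/

namespace LeadingTerm

open Filter

universe u v

variable {K : Type u} [Field K] {L : Type v} [Field L] [CharZero K] [CharZero L]
  {OK : ValuationSubring K} {OL : ValuationSubring L} [HenselianLocalRing OK]
  [HenselianLocalRing OL] {l : Filter (RVMap OK OL)}

theorem approximable_aeval (hl : IsEmbeddingAlong l) {n : ℕ} (x : Fin n → K) :
    Approximable l (MvPolynomial.aeval x : MvPolynomial (Fin n) ℤ →ₐ[ℤ] K).toRingHom := by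
  induction n with
  | zero =>
    convert (approximable_intCast hl).comp (MvPolynomial.isEmptyRingEquiv ℤ (Fin 0)).toRingHom
    refine MvPolynomial.ringHom_ext (fun r => ?_) fun i => i.elim0
    simp
  | succ n ih =>
    -- The first variable is adjoined last, to match `MvPolynomial.finSuccEquiv`.
    convert ((ih (fun i => x i.succ)).adjoin hl (x 0)).comp
      (MvPolynomial.finSuccEquiv ℤ n).toRingEquiv.toRingHom
    refine MvPolynomial.ringHom_ext (fun r => ?_) fun i => ?_
    · simp
    · refine Fin.cases ?_ (fun j => ?_) i
      · simp [MvPolynomial.finSuccEquiv_X_zero]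
      · simp [MvPolynomial.finSuccEquiv_X_succ]

end LeadingTerm

/-! ### Transfer of quantifier-free formulas. -/

namespace LRV

open LeadingTerm ManySorted Filter

universe u v

variable {K : Type u} [Field K] {L : Type v} [Field L]
  {OK : ValuationSubring K} {OL : ValuationSubring L}

/-- The field element carried by an element of a sort, and `0` for the leading term sorts. -/
def fieldPart : (s : Srt) → Carrier OK s → K
  | .VF, a => a
  | .RV _, _ => 0

/-- Transfer of an element of `K` or `RV_N(K)`, given a candidate `z` in case of a field element. -/
def transfer (σ : RVMap OK OL) (z : L) : (s : Srt) → Carrier OK s → Carrier OL s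
  | .VF, _ => z
  | .RV N, ξ => σ N ξ

variable {R : Type*} [CommRing R]

/-- Elements of the same sort over `K` and over `L` correspond to each other under `σ` and a pair
of homomorphisms `φ : R → K`, `ψ : R → L`. -/
def Corresponds (σ : RVMap OK OL) (φ : R →+* K) (ψ : R →+* L) (p : R) :
    (s : Srt) → Carrier OK s → Carrier OL s → Prop
  | .VF, a, b => a = φ p ∧ b = ψ p
  | .RV N, ξ, η => η = σ N ξ

theorem corresponds_transfer (σ : RVMap OK OL) (φ : R →+* K) (ψ : R →+* L) (p : R) (s : Srt)
    (c : Carrier OK s) (h : φ p = fieldPart s c) :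
    Corresponds σ φ ψ p s c (transfer σ (ψ p) s c) := by
  cases s with
  | VF => exact ⟨h.symm, rfl⟩
  | RV N => rfl

variable {l : Filter (RVMap OK OL)} (hl : IsEmbeddingAlong l) (φ : R →+* K)

include hl

/-- Field operations are followed by operations in `R` and respected exactly by every `ψ`; only `rv`
adds a test to `U`. For values in a leading term sort the element `q` plays no role and is set to
`0`. -/
theorem exists_corresponds_funMap {n : ℕ} {ρ : Fin n → Srt} {s : Srt} (f : Fun n ρ s)
    (b : (i : Fin n) → Carrier OK (ρ i)) (p : Fin n → R) :
    ∃ (q : R) (U : Finset (R × ℕ+)), ∀ᶠ σ in l, ∀ (ψ : R →+* L)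
      (c : (i : Fin n) → Carrier OL (ρ i)),
      (∀ q ∈ U, LeadingTerm.rv OL q.2 (ψ q.1) = σ q.2 (LeadingTerm.rv OK q.2 (φ q.1))) →
      (∀ i, Corresponds σ φ ψ (p i) (ρ i) (b i) (c i)) →
      Corresponds σ φ ψ q s (funMap OK f b) (funMap OL f c) := by
  cases f with
  | zeroVF => exact ⟨0, ∅, Eventually.of_forall fun σ ψ c _ _ =>
      ⟨(map_zero φ).symm, (map_zero ψ).symm⟩⟩
  | oneVF => exact ⟨1, ∅, Eventually.of_forall fun σ ψ c _ _ =>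
      ⟨(map_one φ).symm, (map_one ψ).symm⟩⟩
  | addVF => exact ⟨p 0 + p 1, ∅, Eventually.of_forall fun σ ψ c _ hc =>
      ⟨(congrArg₂ (fun a b : K => a + b) (hc 0).1 (hc 1).1).trans (map_add φ _ _).symm,
        (congrArg₂ (fun a b : L => a + b) (hc 0).2 (hc 1).2).trans (map_add ψ _ _).symm⟩⟩
  | negVF => exact ⟨-p 0, ∅, Eventually.of_forall fun σ ψ c _ hc =>
      ⟨(congrArg (fun a : K => -a) (hc 0).1).trans (map_neg φ _).symm,
        (congrArg (fun a : L => -a) (hc 0).2).trans (map_neg ψ _).symm⟩⟩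
  | mulVF => exact ⟨p 0 * p 1, ∅, Eventually.of_forall fun σ ψ c _ hc =>
      ⟨(congrArg₂ (fun a b : K => a * b) (hc 0).1 (hc 1).1).trans (map_mul φ _ _).symm,
        (congrArg₂ (fun a b : L => a * b) (hc 0).2 (hc 1).2).trans (map_mul ψ _ _).symm⟩⟩
  | zeroRV N =>
    refine ⟨0, ∅, ?_⟩
    filter_upwards [hl.zero N] with σ hσ ψ c _ _
    exact hσ.symm
  | oneRV N =>
    refine ⟨0, ∅, ?_⟩
    filter_upwards [hl.one N] with σ hσ ψ c _ _
    change LeadingTerm.rv OL N 1 = σ N (LeadingTerm.rv OK N 1)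
    rw [rv_one, rv_one, hσ]
  | mulRV N =>
    refine ⟨0, ∅, ?_⟩
    filter_upwards [hl.mul N (b 0) (b 1)] with σ hσ ψ c _ hc
    exact (congrArg₂ (fun a b : RV OL N => a * b) (hc 0) (hc 1)).trans hσ.symm
  | rv N =>
    refine ⟨0, {(p 0, N)}, Eventually.of_forall fun σ ψ c hψ hc => ?_⟩
    have h0 := hψ _ (Finset.mem_singleton_self _)
    have h1 := (congrArg (LeadingTerm.rv OL N) (hc 0).2).trans h0
    exact h1.trans (congrArg (fun a => σ N (LeadingTerm.rv OK N a)) (hc 0).1).symm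
  | rvProj N M h =>
    refine ⟨0, ∅, ?_⟩
    filter_upwards [hl.proj h (b 0)] with σ hσ ψ c _ hc
    exact (congrArg (LeadingTerm.rvProj OL h) (hc 0)).trans hσ.symm

theorem eventually_relMap_iff_of_corresponds {n : ℕ} {ρ : Fin n → Srt} (r : Rel n ρ)
    (b : (i : Fin n) → Carrier OK (ρ i)) (p : Fin n → R) :
    ∀ᶠ σ in l, ∀ (ψ : R →+* L) (c : (i : Fin n) → Carrier OL (ρ i)),
      (∀ i, Corresponds σ φ ψ (p i) (ρ i) (b i) (c i)) → (relMap OK r b ↔ relMap OL r c) := by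
  cases r with
  | div N =>
    filter_upwards [hl.dvd_iff N (b 0) (b 1)] with σ hσ ψ c hc
    obtain rfl : c = fun i => σ N (b i) := funext hc
    exact hσ
  | oplus N =>
    filter_upwards [hl.oplus_iff N (b 0) (b 1) (b 2)] with σ hσ ψ c hc
    obtain rfl : c = fun i => σ N (b i) := funext hc
    exact hσ
  | hensel N d =>
    filter_upwards [hl.hensel_iff N d (b 0) (fun i => b i.succ)] with σ hσ ψ c hc
    obtain rfl : c = fun i => σ (henselIndex N d i) (b i) := funext hc
    exact hσ

/-- Equality of field elements is vanishing of the leading term of their difference, so one extra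
test at level `1` decides it. -/
theorem exists_eq_iff_of_corresponds {s : Srt} (a b : Carrier OK s) (p q : R) :
    ∃ U : Finset (R × ℕ+), ∀ᶠ σ in l, ∀ (ψ : R →+* L) (c d : Carrier OL s),
      (∀ q ∈ U, LeadingTerm.rv OL q.2 (ψ q.1) = σ q.2 (LeadingTerm.rv OK q.2 (φ q.1))) →
      Corresponds σ φ ψ p s a c → Corresponds σ φ ψ q s b d → (a = b ↔ c = d) := by
  cases s with
  | VF =>
    refine ⟨{(p - q, 1)}, ?_⟩
    filter_upwards [hl.zero 1, hl.eq_iff 1 (LeadingTerm.rv OK 1 (φ (p - q))) 0]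
      with σ h0 h1 ψ c d hψ hac hbd
    have h2 : LeadingTerm.rv OL 1 (ψ (p - q)) = σ 1 (LeadingTerm.rv OK 1 (φ (p - q))) :=
      hψ _ (Finset.mem_singleton_self _)
    rw [h0, ← h2, rv_eq_zero_iff, rv_eq_zero_iff, map_sub, map_sub, sub_eq_zero, sub_eq_zero] at h1
    obtain ⟨rfl, rfl⟩ := hac
    obtain ⟨rfl, rfl⟩ := hbd
    exact h1
  | RV N =>
    refine ⟨∅, ?_⟩
    filter_upwards [hl.eq_iff N a b] with σ hσ ψ c d _ hac hbd
    obtain rfl : c = σ N a := hac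
    obtain rfl : d = σ N b := hbd
    exact hσ

variable {k : ℕ} {τ : Fin k → Srt} (y : (i : Fin k) → Carrier OK (τ i)) (z : Fin k → R)
  (hz : ∀ i, φ (z i) = fieldPart (τ i) (y i))

include hz

theorem exists_corresponds_eval {s : Srt} (t : Term lang τ s) :
    ∃ (p : R) (T : Finset (R × ℕ+)), ∀ᶠ σ in l, ∀ ψ : R →+* L,
      (∀ q ∈ T, LeadingTerm.rv OL q.2 (ψ q.1) = σ q.2 (LeadingTerm.rv OK q.2 (φ q.1))) →
      Corresponds σ φ ψ p s (t.eval (str OK) y)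
        (t.eval (str OL) fun i => transfer σ (ψ (z i)) (τ i) (y i)) := by
  classical
  induction t with
  | var i =>
    exact ⟨z i, ∅, Eventually.of_forall fun σ ψ _ => corresponds_transfer σ φ ψ _ _ _ (hz i)⟩
  | app f t ih =>
    choose p T h using ih
    obtain ⟨q, U, hq⟩ := exists_corresponds_funMap hl φ f (fun i => (t i).eval (str OK) y) p
    refine ⟨q, U ∪ Finset.univ.biUnion T, ?_⟩
    filter_upwards [eventually_all.2 h, hq] with σ h1 h2 ψ hψ
    refine h2 ψ _ (fun q hq => hψ q (Finset.mem_union_left _ hq)) fun i => ?_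
    exact h1 i ψ fun q hq => hψ q (Finset.mem_union_right _
      (Finset.mem_biUnion.2 ⟨i, Finset.mem_univ i, hq⟩))

theorem exists_realize_iff (θ : QFFormula lang τ) :
    ∃ T : Finset (R × ℕ+), ∀ᶠ σ in l, ∀ ψ : R →+* L,
      (∀ q ∈ T, LeadingTerm.rv OL q.2 (ψ q.1) = σ q.2 (LeadingTerm.rv OK q.2 (φ q.1))) →
      (θ.Realize (str OK) y ↔
        θ.Realize (str OL) fun i => transfer σ (ψ (z i)) (τ i) (y i)) := by
  classical
  induction θ with
  | falsum => exact ⟨∅, Eventually.of_forall fun _ _ _ => Iff.rfl⟩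
  | @equal s t₁ t₂ =>
    obtain ⟨p₁, T₁, h₁⟩ := exists_corresponds_eval hl φ y z hz t₁
    obtain ⟨p₂, T₂, h₂⟩ := exists_corresponds_eval hl φ y z hz t₂
    obtain ⟨U, hU⟩ := exists_eq_iff_of_corresponds hl φ (t₁.eval (str OK) y) (t₂.eval (str OK) y)
      p₁ p₂
    refine ⟨T₁ ∪ T₂ ∪ U, ?_⟩
    filter_upwards [h₁, h₂, hU] with σ h1 h2 h3 ψ hψ
    exact h3 ψ _ _ (fun q hq => hψ q (Finset.mem_union_right _ hq))
      (h1 ψ fun q hq => hψ q (Finset.mem_union_left _ (Finset.mem_union_left _ hq)))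
      (h2 ψ fun q hq => hψ q (Finset.mem_union_left _ (Finset.mem_union_right _ hq)))
  | rel r t =>
    choose p T h using fun i => exists_corresponds_eval hl φ y z hz (t i)
    refine ⟨Finset.univ.biUnion T, ?_⟩
    filter_upwards [eventually_all.2 h, eventually_relMap_iff_of_corresponds hl φ r
      (fun i => (t i).eval (str OK) y) p] with σ h1 h2 ψ hψ
    exact h2 ψ _ fun i => h1 i ψ fun q hq =>
      hψ q (Finset.mem_biUnion.2 ⟨i, Finset.mem_univ i, hq⟩)
  | not θ ih =>
    obtain ⟨T, h⟩ := ih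
    refine ⟨T, ?_⟩
    filter_upwards [h] with σ hσ ψ hψ
    exact not_congr (hσ ψ hψ)
  | and θ₁ θ₂ ih₁ ih₂ =>
    obtain ⟨T₁, h₁⟩ := ih₁
    obtain ⟨T₂, h₂⟩ := ih₂
    refine ⟨T₁ ∪ T₂, ?_⟩
    filter_upwards [h₁, h₂] with σ hσ₁ hσ₂ ψ hψ
    exact and_congr (hσ₁ ψ fun q hq => hψ q (Finset.mem_union_left _ hq))
      (hσ₂ ψ fun q hq => hψ q (Finset.mem_union_right _ hq))
  | or θ₁ θ₂ ih₁ ih₂ =>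
    obtain ⟨T₁, h₁⟩ := ih₁
    obtain ⟨T₂, h₂⟩ := ih₂
    refine ⟨T₁ ∪ T₂, ?_⟩
    filter_upwards [h₁, h₂] with σ hσ₁ hσ₂ ψ hψ
    exact or_congr (hσ₁ ψ fun q hq => hψ q (Finset.mem_union_left _ hq))
      (hσ₂ ψ fun q hq => hψ q (Finset.mem_union_right _ hq))

end LRV

theorem mainTheorem5 {K : Type*} [Field K] [CharZero K] (OK : ValuationSubring K)
    [HenselianLocalRing OK] (hK : OK ≠ ⊤)
    {L : Type*} [Field L] [CharZero L] (OL : ValuationSubring L)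
    [HenselianLocalRing OL] (hL : OL ≠ ⊤) :
    (LRV.str OL).Models (LRV.str OK).existentialTheory ↔
      (LRV.strRV OL).Models (LRV.strRV OK).existentialTheory := by
  refine ⟨fun h => h.restrict _, fun h => ?_⟩
  rintro ⟨k, τ, θ⟩ ⟨y, hy⟩
  have := LRV.rvFilter_neBot h
  have hl := LRV.isEmbeddingAlong_rvFilter (OK := OK) (OL := OL)
  -- Coordinates in leading term sorts are replaced by the dummy value `0`; they are transferred by
  -- `σ` itself.
  set x : Fin k → K := fun i => LRV.fieldPart (τ i) (y i)
  obtain ⟨T, hT⟩ := LRV.exists_realize_iff hl _ y MvPolynomial.X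
    (fun i => show MvPolynomial.aeval x (MvPolynomial.X i : MvPolynomial (Fin k) ℤ) = _ by simp [x])
    θ
  obtain ⟨σ, h1, ψ, hψ⟩ := (hT.and (LeadingTerm.approximable_aeval hl x T)).exists
  exact ⟨_, (h1 ψ hψ).1 hy⟩
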